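/- Let $\mathbb E$ be a finite-dimensional real vector space with dual $\mathbb E^*$, and let $F$ be a $\nu$-self-concordant barrier with domain $\mathrm{dom}\,F$. This means that $\mathrm{dom}\,F$ is open and convex; $F$ is convex, closed (its epigraph $\{(x,s)\in\mathrm{dom}\,F\times\mathbb R: F(x)\le s\}$ is closed in $\mathbb E\times\mathbb R$) and three times continuously differentiable on $\mathrm{dom}\,F$; and for all $x\in\mathrm{dom}\,F$ and $h\in\mathbb E$ $$|D^3F(x)[h]^3|\le 2\langle\nabla^2F(x)h,h\rangle^{3/2},\qquad \sup_{y\in\mathbb E}\,[2\langle\nabla F(x),y\rangle-\langle\nabla^2F(x)y,y\rangle]\le\nu .$$ Put $\|g\|_x^*=\langle g,[\nabla^2F(x)]^{-1}g\rangle^{1/2}$ for $g\in\mathbb E^*$. Let $Q=\overline{\mathrm{dom}\,F}$ be bounded with non-empty interior, let $x_F^*=\arg\min F$ be the analytic center of $Q$, let $0\ne c\in\mathbb E^*$, and let $x^*\in Q$ minimize $\langle c,x\rangle$ over $Q$. Let $\beta=0.06$ and $\gamma=0.254$. The predictor-corrector path-following scheme starts from $t_0=0$ and $x_0\in\mathrm{dom}\,F$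 with $\|\nabla F(x_0)\|^*_{x_0}\le\beta$, and iterates, for $k\ge 0$, $$t_{k+1}=t_k+\frac{\gamma}{\|c\|^*_{x_k}},\qquad y_k=x_k-\frac{\gamma}{\|c\|^*_{x_k}}[\nabla^2F(x_k)]^{-1}c,\qquad x_{k+1}=y_k-[\nabla^2F(y_k)]^{-1}(\nabla F(y_k)+t_{k+1}c).$$ For $\varepsilon>0$ let $$L_\varepsilon=\max\Big\{1,\ \ln\frac{\nu\|c\|^*_{x_F^*}}{\varepsilon}\Big\}.$$ Theorem. There is an absolute constant $C>0$ (independent of $\mathbb E$, $F$, $\nu$, $c$, $x_0$ and $\varepsilon$) such that for every $\varepsilon>0$ the following holds. 1. For every integer $N\ge C\,\frac{\sqrt\nu}{\gamma}\,L_\varepsilon$ one has $x_N\in Q$ and $|\langle c,x_N\rangle-\langle c,x^*\rangle|\le\varepsilon$; that is, $N_\varepsilon=O\big(\frac{\sqrt\nu}{\gamma}\ln\frac{\nu\|c\|^*_{x_F^*}}{\varepsilon}\big)$ iterations suffice. 2. The main part of the complexity bound has constant $3.94$ (here $1/\gamma=3.937\ldots$): the same conclusion holds for every integer $N\ge 3.94\,\sqrt\nu\,L_\varepsilon+C(\sqrt\nu+L_\varepsilon)$.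 3. For the classical one-step path-following scheme, which starts from $t_0=0$ and $x_0\in\mathrm{dom}\,F$ with $\|\nabla F(x_0)\|^*_{x_0}\le\frac19$ and iterates $t_{k+1}=t_k+\frac{5/36}{\|c\|^*_{x_k}}$, $x_{k+1}=x_k-[\nabla^2F(x_k)]^{-1}(\nabla F(x_k)+t_{k+1}c)$, the corresponding constant is $7.2=36/5$: its iterates satisfy $x_N\in Q$ and $|\langle c,x_N\rangle-\langle c,x^*\rangle|\le\varepsilon$ for every integer $N\ge 7.2\,\sqrt\nu\,L_\varepsilon+C(\sqrt\nu+L_\varepsilon)$. -/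

import Mathlib

set_option maxSynthPendingDepth 3

noncomputable section

namespace PCPFS

variable {E : Type*} [NormedAddCommGroup E] [NormedSpace ℝ E]

/-- The gradient `∇F(x)`, an element of the dual space `E*`. -/
def grad (F : E → ℝ) (x : E) : E →L[ℝ] ℝ := fderiv ℝ F x

/-- The Hessian `∇²F(x) : E → E*`, so that `⟨∇²F(x) h, k⟩` is `hess F x h k`. -/
def hess (F : E → ℝ) (x : E) : E →L[ℝ] E →L[ℝ] ℝ := fderiv ℝ (grad F) x

/-- The third derivative: `D³F(x)[h]` is the derivative of the Hessian at `x` in direction `h`, and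
`D³F(x)[h]³` is `third F x h h h`. -/
def third (F : E → ℝ) (x : E) : E →L[ℝ] E →L[ℝ] E →L[ℝ] ℝ := fderiv ℝ (hess F) x

/-- The inverse Hessian `[∇²F(x)]⁻¹ : E* → E`. -/
def hessInv (F : E → ℝ) (x : E) : (E →L[ℝ] ℝ) →L[ℝ] E := (hess F x).inverse

/-- The local dual norm `‖g‖*_x = ⟨g, [∇²F(x)]⁻¹ g⟩^{1/2}`. -/
def dualNorm (F : E → ℝ) (x : E) (g : E →L[ℝ] ℝ) : ℝ := √(g (hessInv F x g))

/-- `F`, with effective domain the open convex set `D` (so `F = +∞` outside `D`), is a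
self-concordant function with constant `M`: it is closed (its epigraph is closed), convex, three
times continuously differentiable on `D`, and `|D³F(x)[h]³| ≤ 2 M ⟨∇²F(x) h, h⟩^{3/2}`. -/
structure IsSelfConcordant (M : ℝ) (D : Set E) (F : E → ℝ) : Prop where
  isOpen_dom : IsOpen D
  convexOn : ConvexOn ℝ D F
  contDiffOn : ContDiffOn ℝ 3 F D
  isClosed_epigraph : IsClosed {p : E × ℝ | p.1 ∈ D ∧ F p.1 ≤ p.2}
  third_le : ∀ x ∈ D, ∀ h : E, |third F x h h h| ≤ 2 * M * (hess F x h h) ^ (3 / 2 : ℝ)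

/-- `F` is a `ν`-self-concordant barrier for the closure of its domain `D`: it is standard
self-concordant and `sup_y [2⟨∇F(x), y⟩ - ⟨∇²F(x) y, y⟩] ≤ ν` for all `x ∈ D`. -/
structure IsSelfConcordantBarrier (ν : ℝ) (D : Set E) (F : E → ℝ) : Prop where
  selfConcordant : IsSelfConcordant 1 D F
  barrier : ∀ x ∈ D, ∀ y : E, 2 * grad F x y - hess F x y y ≤ ν

/-- `x` is the analytic center: the minimizer of the barrier `F` over its domain `D`. -/
def IsAnalyticCenter (D : Set E) (F : E → ℝ) (x : E) : Prop := x ∈ D ∧ IsMinOn F D x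

/-- The centering parameter `β` of the predictor-corrector scheme. -/
def pcBeta : ℝ := 0.06

/-- The step size `γ` of the predictor-corrector scheme. -/
def pcGamma : ℝ := 0.254

/-- One predictor-corrector iteration `(t, x) ↦ (t₊, x₊)`:
`t₊ = t + γ / ‖c‖*_x`, `y = x - (γ / ‖c‖*_x) [∇²F(x)]⁻¹ c`,
`x₊ = y - [∇²F(y)]⁻¹ (∇F(y) + t₊ c)`. -/
def pcStep (F : E → ℝ) (c : E →L[ℝ] ℝ) (p : ℝ × E) : ℝ × E :=
  let t' : ℝ := p.1 + pcGamma / dualNorm F p.2 c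
  let y : E := p.2 - (pcGamma / dualNorm F p.2 c) • hessInv F p.2 c
  (t', y - hessInv F y (grad F y + t' • c))

/-- The `k`-th iterate `(t_k, x_k)` of the predictor-corrector scheme, with `t_0 = 0`. -/
def pcIter (F : E → ℝ) (c : E →L[ℝ] ℝ) (x₀ : E) : ℕ → ℝ × E
  | 0 => (0, x₀)
  | k + 1 => pcStep F c (pcIter F c x₀ k)

/-- The centering parameter `β` of the classical one-step path-following scheme. -/
def classicalBeta : ℝ := 1 / 9

/-- The step size `γ` of the classical one-step path-following scheme. -/
def classicalGamma : ℝ := 5 / 36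

/-- One iteration of the classical path-following scheme:
`t₊ = t + γ / ‖c‖*_x`, `x₊ = x - [∇²F(x)]⁻¹ (∇F(x) + t₊ c)`. -/
def classicalStep (F : E → ℝ) (c : E →L[ℝ] ℝ) (p : ℝ × E) : ℝ × E :=
  let t' : ℝ := p.1 + classicalGamma / dualNorm F p.2 c
  (t', p.2 - hessInv F p.2 (grad F p.2 + t' • c))

/-- The `k`-th iterate `(t_k, x_k)` of the classical scheme, with `t_0 = 0`. -/
def classicalIter (F : E → ℝ) (c : E →L[ℝ] ℝ) (x₀ : E) : ℕ → ℝ × E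
  | 0 => (0, x₀)
  | k + 1 => classicalStep F c (classicalIter F c x₀ k)

/-- The logarithmic factor `max {1, ln (ν ‖c‖*_{x_F*} / ε)}`, where `xF` is the analytic center. -/
def logFactor (ν : ℝ) (F : E → ℝ) (c : E →L[ℝ] ℝ) (xF : E) (ε : ℝ) : ℝ :=
  max 1 (Real.log (ν * dualNorm F xF c / ε))

end PCPFS

end

/-! Both schemes keep the iterate close to the central path, meaning that the local dual norm of
`∇F(x) + t c` never exceeds `β`, while `t` grows geometrically. Only the size of the step `γ`
tolerated by this invariant differs, and the leading constant is `1/γ`.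

The geometry rests on one fact. A symmetric trilinear form bounded on the diagonal is bounded with
the same constant at `(h, u, u)`, so self-concordance controls `D³F(x)[h, u, u]` in the local norm.
Integrating along segments compares Hessians at `x` and `x + h` up to factors `(1 - ‖h‖_x)^{±2}`
(`hess_add_le`, `le_hess_add`) and bounds the linearization error of the gradient by `r²/(1 - r)`,
where `r = ‖h‖_x`. Hence `dualNorm_grad_add_le`, which covers the predictor step (the predicted
residual is the old one) and the Newton step (the predicted residual is zero, so the error is
squared).

The rate comes from the barrier inequality `|∇F(x) u| ≤ √ν ‖u‖_x`. Near the central path it gives `t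
‖c‖*_x ≤ β + √ν`, so each step multiplies `t` by at least `1 + γ/(β + √ν)`. Since `t_0 = 0`, the
growth starts from `t_1`, which is at least a constant over the norm of `c` at the analytic center.
The gap at a centered point is `O(ν)/t`, by `⟨∇F(z), y - z⟩ ≤ ν` at the exact minimizer `z` of `F +
t c`. Taking logarithms yields the count; `√ν ≥ 1/6` absorbs the lower-order constants. -/

namespace PCPFS

variable {E : Type*} [NormedAddCommGroup E] [NormedSpace ℝ E]

/-! ### Positive definite forms and symmetric trilinear forms -/

/-- A symmetric form dominated by `κ H` on the diagonal is dominated by `κ` times the product of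
the `H`-norms. -/
theorem abs_apply_le_of_diag {G H : E →L[ℝ] E →L[ℝ] ℝ} {κ : ℝ}
    (hG : ∀ u v, G u v = G v u) (hpos : ∀ u, u ≠ 0 → 0 < H u u) (hH : ∀ u v, H u v = H v u)
    (hGH : ∀ u, |G u u| ≤ κ * H u u) (u v : E) :
    |G u v| ≤ κ * √(H u u) * √(H v v) := by
  rcases eq_or_ne u 0 with rfl | hu
  · simp
  rcases eq_or_ne v 0 with rfl | hv
  · simp
  have key : ∀ x y : E, |G x y| ≤ κ * ((H x x + H y y) / 2) := by
    intro x y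
    have h1 := abs_le.1 (hGH (x + y))
    have h2 := abs_le.1 (hGH (x - y))
    simp only [map_add, map_sub, add_apply, sub_apply]
      at h1 h2
    rw [hG y x, hH y x] at h1 h2
    rw [abs_le]
    constructor <;> linarith
  have ha := Real.sqrt_pos.2 (hpos u hu)
  have hb := Real.sqrt_pos.2 (hpos v hv)
  have ha2 := Real.sq_sqrt (hpos u hu).le
  have hb2 := Real.sq_sqrt (hpos v hv).le
  set a := √(H u u)
  set b := √(H v v)
  -- Polarization gives only the arithmetic mean of `H x x` and `H y y`. Rescaling makes the two
  -- values equal, which turns the mean into the product.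
  have h := key (b • u) (a • v)
  simp only [map_smul, smul_apply, smul_eq_mul, ← ha2, ← hb2, abs_mul,
    abs_of_pos ha, abs_of_pos hb] at h
  have hab : 0 < a * b := mul_pos ha hb
  refine le_of_mul_le_mul_left ?_ hab
  nlinarith

/-- The Cauchy–Schwarz inequality for a positive definite form. -/
theorem abs_apply_le_sqrt_mul_sqrt {H : E →L[ℝ] E →L[ℝ] ℝ}
    (hpos : ∀ u, u ≠ 0 → 0 < H u u) (hH : ∀ u v, H u v = H v u) (u v : E) :
    |H u v| ≤ √(H u u) * √(H v v) := by
  have h0 : ∀ u, 0 ≤ H u u := fun u => by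
    rcases eq_or_ne u 0 with rfl | hu
    · simp
    · exact (hpos u hu).le
  simpa using abs_apply_le_of_diag (κ := 1) hH hpos hH (fun u => by simp [abs_of_nonneg (h0 u)]) u v

theorem apply_inverse_of_pos [FiniteDimensional ℝ E] {H : E →L[ℝ] E →L[ℝ] ℝ}
    (hpos : ∀ u, u ≠ 0 → 0 < H u u) (g : E →L[ℝ] ℝ) : H (H.inverse g) = g := by
  have hinj : Function.Injective H.toLinearMap := by
    rw [← LinearMap.ker_eq_bot, LinearMap.ker_eq_bot']
    intro u hu
    by_contra h
    have := hpos u h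
    have h2 : H u = 0 := hu
    simp [h2] at this
  have hdim : Module.finrank ℝ E = Module.finrank ℝ (E →L[ℝ] ℝ) := by
    rw [← (LinearMap.toContinuousLinearMap (𝕜 := ℝ) (E := E) (F' := ℝ)).finrank_eq]
    exact (Subspace.dual_finrank_eq (K := ℝ) (V := E)).symm
  let e : E ≃L[ℝ] (E →L[ℝ] ℝ) :=
    (LinearEquiv.ofInjectiveOfFinrankEq H.toLinearMap hinj hdim).toContinuousLinearEquiv
  have he : H = (e : E →L[ℝ] E →L[ℝ] ℝ) := by
    ext u v
    rfl
  have : H.IsInvertible := ⟨e, he.symm⟩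
  exact this.self_apply_inverse g

/-- A binary cubic form bounded by one on the unit circle satisfies the Bernstein–Szegő bound. -/
theorem abs_cubic_le {p q r s : ℝ}
    (h : ∀ a b : ℝ, a ^ 2 + b ^ 2 = 1 →
      |p * a ^ 3 + 3 * q * a ^ 2 * b + 3 * r * a * b ^ 2 + s * b ^ 3| ≤ 1)
    {c d : ℝ} (hcd : c ^ 2 + d ^ 2 = 1) :
    |(4 * c ^ 3 - 3 * c) * p + (3 * d - 4 * d ^ 3) * q| ≤ 1 := by
  obtain ⟨k, hk⟩ : ∃ k : ℝ, k ^ 2 = 3 := ⟨√3, Real.sq_sqrt (by norm_num)⟩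
  have h1 := h c d hcd
  have h2 := h (-c / 2 - k / 2 * d) (-d / 2 + k / 2 * c)
    (by linear_combination hcd + (c ^ 2 + d ^ 2) / 4 * (hk))
  have h3 := h (-c / 2 + k / 2 * d) (-d / 2 - k / 2 * c)
    (by linear_combination hcd + (c ^ 2 + d ^ 2) / 4 * (hk))
  set a₂ := -c / 2 - k / 2 * d with ha₂
  set b₂ := -d / 2 + k / 2 * c with hb₂
  set a₃ := -c / 2 + k / 2 * d with ha₃
  set b₃ := -d / 2 - k / 2 * c with hb₃
  -- With `c = cos θ` and `d = sin θ`, the nodes are `θ` and its rotations by `± 2π/3`, which all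
  -- have the same triple angle up to full turns. The weights are `(sin 3φ / (3 sin φ))²` at the
  -- nodes `φ`. They sum to one and their cubic moments retain exactly `cos 3θ · p + sin 3θ · q`,
  -- which is thus a convex combination of values of the cubic.
  have w : (4 * c ^ 2 - 1) ^ 2 / 9 + (4 * a₂ ^ 2 - 1) ^ 2 / 9 + (4 * a₃ ^ 2 - 1) ^ 2 / 9 = 1 := by
    grind
  have e0 : (4 * c ^ 2 - 1) ^ 2 / 9 * c ^ 3 + (4 * a₂ ^ 2 - 1) ^ 2 / 9 * a₂ ^ 3
      + (4 * a₃ ^ 2 - 1) ^ 2 / 9 * a₃ ^ 3 = 4 * c ^ 3 - 3 * c := by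
    grind
  have e1 : (4 * c ^ 2 - 1) ^ 2 / 9 * (c ^ 2 * d) + (4 * a₂ ^ 2 - 1) ^ 2 / 9 * (a₂ ^ 2 * b₂)
      + (4 * a₃ ^ 2 - 1) ^ 2 / 9 * (a₃ ^ 2 * b₃) = (3 * d - 4 * d ^ 3) / 3 := by
    grind
  have e2 : (4 * c ^ 2 - 1) ^ 2 / 9 * (c * d ^ 2) + (4 * a₂ ^ 2 - 1) ^ 2 / 9 * (a₂ * b₂ ^ 2)
      + (4 * a₃ ^ 2 - 1) ^ 2 / 9 * (a₃ * b₃ ^ 2) = 0 := by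
    grind
  have e3 : (4 * c ^ 2 - 1) ^ 2 / 9 * d ^ 3 + (4 * a₂ ^ 2 - 1) ^ 2 / 9 * b₂ ^ 3
      + (4 * a₃ ^ 2 - 1) ^ 2 / 9 * b₃ ^ 3 = 0 := by
    grind
  clear_value a₂ b₂ a₃ b₃
  generalize hw1 : (4 * c ^ 2 - 1) ^ 2 / 9 = w1 at *
  generalize hw2 : (4 * a₂ ^ 2 - 1) ^ 2 / 9 = w2 at *
  generalize hw3 : (4 * a₃ ^ 2 - 1) ^ 2 / 9 = w3 at *
  have w1n : 0 ≤ w1 := by rw [← hw1]; positivity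
  have w2n : 0 ≤ w2 := by rw [← hw2]; positivity
  have w3n : 0 ≤ w3 := by rw [← hw3]; positivity
  have key : (4 * c ^ 3 - 3 * c) * p + (3 * d - 4 * d ^ 3) * q
      = w1 * (p * c ^ 3 + 3 * q * c ^ 2 * d + 3 * r * c * d ^ 2 + s * d ^ 3)
      + w2 * (p * a₂ ^ 3 + 3 * q * a₂ ^ 2 * b₂ + 3 * r * a₂ * b₂ ^ 2 + s * b₂ ^ 3)
      + w3 * (p * a₃ ^ 3 + 3 * q * a₃ ^ 2 * b₃ + 3 * r * a₃ * b₃ ^ 2 + s * b₃ ^ 3) := by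
    linear_combination -p * e0 - 3 * q * e1 - 3 * r * e2 - s * e3
  rw [key]
  rw [abs_le] at *
  constructor
  · linarith [mul_le_mul_of_nonneg_left h1.1 w1n, mul_le_mul_of_nonneg_left h2.1 w2n,
      mul_le_mul_of_nonneg_left h3.1 w3n]
  · linarith [mul_le_mul_of_nonneg_left h1.2 w1n, mul_le_mul_of_nonneg_left h2.2 w2n,
      mul_le_mul_of_nonneg_left h3.2 w3n]

/-- Every point of the unit circle has an angle of the form `3θ`. In terms of the polar form `A` of
the cubic, `a p + b q` is `A h u u` with `u = (1, 0)` and `h = (a, b)`. -/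
theorem abs_cubic_le_of_sq_add_sq {p q r s : ℝ}
    (h : ∀ a b : ℝ, a ^ 2 + b ^ 2 = 1 →
      |p * a ^ 3 + 3 * q * a ^ 2 * b + 3 * r * a * b ^ 2 + s * b ^ 3| ≤ 1)
    {a b : ℝ} (hab : a ^ 2 + b ^ 2 = 1) : |a * p + b * q| ≤ 1 := by
  obtain ⟨α, rfl, rfl⟩ : ∃ α : ℝ, a = Real.cos α ∧ b = Real.sin α := by
    have hz : (⟨a, b⟩ : ℂ) ≠ 0 := by
      intro hz
      have h1 := congrArg Complex.re hz
      have h2 := congrArg Complex.im hz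
      simp at h1 h2
      simp [h1, h2] at hab
    have hn : ‖(⟨a, b⟩ : ℂ)‖ = 1 := by
      rw [Complex.norm_eq_sqrt_sq_add_sq, hab, Real.sqrt_one]
    refine ⟨Complex.arg ⟨a, b⟩, ?_, ?_⟩
    · rw [Complex.cos_arg hz, hn, div_one]
    · rw [Complex.sin_arg, hn, div_one]
  have e : α = 3 * (α / 3) := by ring
  rw [e, Real.cos_three_mul, Real.sin_three_mul]
  exact abs_cubic_le h (Real.cos_sq_add_sin_sq _)

/-- A symmetric trilinear form bounded by `M ‖h‖³` on the diagonal is bounded by `M ‖h‖ ‖u‖²` at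
`(h, u, u)`, where the norm is that of a positive definite form. -/
theorem abs_trilinear_le {A : E →L[ℝ] E →L[ℝ] E →L[ℝ] ℝ} {H : E →L[ℝ] E →L[ℝ] ℝ} {M : ℝ}
    (hM : 0 < M)
    (hA₁ : ∀ u v w, A u v w = A v u w) (hA₂ : ∀ u v w, A u v w = A u w v)
    (hpos : ∀ u, u ≠ 0 → 0 < H u u) (hH : ∀ u v, H u v = H v u)
    (hAH : ∀ h, |A h h h| ≤ M * √(H h h) ^ 3) (h u : E) :
    |A h u u| ≤ M * √(H h h) * H u u := by
  have hnn : ∀ u, 0 ≤ H u u := fun u => by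
    rcases eq_or_ne u 0 with rfl | hu
    · simp
    · exact (hpos u hu).le
  have unit : ∀ h u : E, H h h = 1 → H u u = 1 → |A h u u| ≤ M := by
    intro h u hh hu
    -- Gram–Schmidt: only the plane spanned by `u` and `h` matters, and in an `H`-orthonormal basis
    -- of it the form is a binary cubic bounded on the unit circle.
    obtain ⟨w, hw⟩ : ∃ w, w = h - (H h u) • u := ⟨_, rfl⟩
    set a := H h u with ha
    have huw : H u w = 0 := by
      rw [hw]; simp [hu, hH u h, ← ha]
    have hww : H w w = 1 - a ^ 2 := by
      rw [hw]; simp [hu, hh, hH u h, ← ha]; ring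
    have hdec : h = a • u + w := by rw [hw]; abel
    rcases eq_or_ne w 0 with h0 | h0
    · have ha1 : a ^ 2 = 1 := by simp [h0] at hww; linarith
      have : |a| = 1 := by rw [← sq_eq_sq₀ (abs_nonneg _) zero_le_one, sq_abs, ha1, one_pow]
      have h3 := hAH u
      rw [hdec, h0, add_zero]
      simpa [abs_mul, this, hu] using h3
    · have hb := Real.sqrt_pos.2 (hpos w h0)
      have hb2 := Real.sq_sqrt (hpos w h0).le
      set b := √(H w w)
      obtain ⟨v, hv⟩ : ∃ v, v = b⁻¹ • w := ⟨_, rfl⟩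
      have hwv : w = b • v := by rw [hv, smul_smul, mul_inv_cancel₀ hb.ne', one_smul]
      have huv : H u v = 0 := by rw [hv]; simp [huw]
      have hvv : H v v = 1 := by rw [hv]; simp [← hb2]; field_simp
      have hab : a ^ 2 + b ^ 2 = 1 := by rw [hb2, hww]; ring
      have := abs_cubic_le_of_sq_add_sq (p := A u u u / M) (q := A v u u / M) (r := A u v v / M)
        (s := A v v v / M) (fun x y hxy => ?_) hab
      · rw [hdec, hwv]
        have e : a * (A u u u / M) + b * (A v u u / M) = (A (a • u + b • v) u u) / M := by
          simp; field_simp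
        rw [e, abs_div, abs_of_pos hM, div_le_one hM] at this
        exact this
      · have h3 := hAH (x • u + y • v)
        have e1 : H (x • u + y • v) (x • u + y • v) = 1 := by
          simp [hu, hvv, huv, hH v u]; linarith
        rw [e1] at h3
        have e2 : x ^ 3 * (A u u u) + 3 * x ^ 2 * y * A v u u + 3 * x * y ^ 2 * A u v v
            + y ^ 3 * A v v v = A (x • u + y • v) (x • u + y • v) (x • u + y • v) := by
          simp only [map_add, map_smul, add_apply,
            smul_apply, smul_eq_mul]
          rw [hA₂ u u v, hA₁ u v u, hA₂ v v u, hA₁ v u v]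
          ring
        rw [← e2, Real.sqrt_one, one_pow, mul_one] at h3
        have e3 : A u u u / M * x ^ 3 + 3 * (A v u u / M) * x ^ 2 * y
            + 3 * (A u v v / M) * x * y ^ 2 + A v v v / M * y ^ 3
            = (x ^ 3 * (A u u u) + 3 * x ^ 2 * y * A v u u + 3 * x * y ^ 2 * A u v v
            + y ^ 3 * A v v v) / M := by field_simp
        rw [e3, abs_div, abs_of_pos hM, div_le_one hM]
        exact h3
  rcases eq_or_ne h 0 with rfl | hh
  · simp
  rcases eq_or_ne u 0 with rfl | hu
  · simp
  have ha := Real.sqrt_pos.2 (hpos h hh)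
  have hb := Real.sqrt_pos.2 (hpos u hu)
  have ha2 := Real.sq_sqrt (hpos h hh).le
  have hb2 := Real.sq_sqrt (hpos u hu).le
  set a := √(H h h)
  set b := √(H u u)
  have := unit (a⁻¹ • h) (b⁻¹ • u) (by simp [← ha2]; field_simp) (by simp [← hb2]; field_simp)
  simp only [map_smul, smul_apply, smul_eq_mul, abs_mul, abs_inv,
    abs_of_pos ha, abs_of_pos hb] at this
  rw [← hb2]
  have e : b⁻¹ * (b⁻¹ * (a⁻¹ * |A h u u|)) = |A h u u| / (a * b ^ 2) := by field_simp
  have e' : |A h u u| / (a * b ^ 2) ≤ M := by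
    rwa [← e]
  rw [div_le_iff₀ (by positivity)] at e'
  linarith

/-! ### Comparison of derivatives on an interval -/

open Set Filter Topology

theorem le_of_hasDerivAt_le {f f' g g' : ℝ → ℝ} {T : ℝ} (hT : 0 ≤ T)
    (hf : ∀ t ∈ Icc 0 T, HasDerivAt f (f' t) t) (hg : ∀ t ∈ Icc 0 T, HasDerivAt g (g' t) t)
    (h : ∀ t ∈ Icc 0 T, f' t ≤ g' t) (h0 : f 0 ≤ g 0) : f T ≤ g T :=
  image_le_of_deriv_right_le_deriv_boundary
    (fun t ht => (hf t ht).continuousAt.continuousWithinAt)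
    (fun t ht => (hf t (Ico_subset_Icc_self ht)).hasDerivWithinAt) h0
    (fun t ht => (hg t ht).continuousAt.continuousWithinAt)
    (fun t ht => (hg t (Ico_subset_Icc_self ht)).hasDerivWithinAt)
    (fun t ht => h t (Ico_subset_Icc_self ht)) ⟨hT, le_rfl⟩

theorem hasDerivAt_mul_left (r t : ℝ) : HasDerivAt (fun s : ℝ => r * s) r t := by
  simpa using (hasDerivAt_id' t).const_mul r

theorem hasDerivAt_affine (a b t : ℝ) : HasDerivAt (fun s : ℝ => a + b * s) b t :=
  (hasDerivAt_mul_left b t).const_add a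

/-- If `q > 0` and `|q'| ≤ 2 q^{3/2}`, then `q^{-1/2}` is `1`-Lipschitz. -/
theorem abs_inv_sqrt_sub_le {q q' : ℝ → ℝ} {T : ℝ} (hT : 0 ≤ T)
    (hq : ∀ t ∈ Icc 0 T, HasDerivAt q (q' t) t) (hpos : ∀ t ∈ Icc 0 T, 0 < q t)
    (hb : ∀ t ∈ Icc 0 T, |q' t| ≤ 2 * (q t * √(q t))) :
    |(√(q T))⁻¹ - (√(q 0))⁻¹| ≤ T := by
  have hd : ∀ t ∈ Icc 0 T, HasDerivAt (fun s => (√(q s))⁻¹)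
      (-(q' t / (2 * √(q t))) / √(q t) ^ 2) t := fun t ht =>
    ((hq t ht).sqrt (hpos t ht).ne').inv (Real.sqrt_pos.2 (hpos t ht)).ne'
  have hbd : ∀ t ∈ Icc 0 T, |-(q' t / (2 * √(q t))) / √(q t) ^ 2| ≤ 1 := by
    intro t ht
    have h1 := Real.sqrt_pos.2 (hpos t ht)
    have h2 := Real.sq_sqrt (hpos t ht).le
    have h3 := hb t ht
    rw [← h2] at h3
    simp only [Real.sqrt_sq h1.le] at h3
    have e : -(q' t / (2 * √(q t))) / √(q t) ^ 2 = -q' t / (2 * √(q t) ^ 3) := by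
      field_simp
    rw [e, abs_div, abs_neg, abs_of_pos (by positivity : 0 < 2 * √(q t) ^ 3),
      div_le_one (by positivity)]
    linarith
  rw [abs_le]
  constructor
  · have := le_of_hasDerivAt_le (f := fun t => (√(q 0))⁻¹ - t) (f' := fun _ => -1) hT
      (fun t _ => by simpa using (hasDerivAt_id t).const_sub ((√(q 0))⁻¹)) hd
      (fun t ht => (abs_le.1 (hbd t ht)).1) (by simp)
    linarith
  · have := le_of_hasDerivAt_le (g := fun t => (√(q 0))⁻¹ + t) (g' := fun _ => 1) hT hd
      (fun t _ => by simpa using (hasDerivAt_id t).const_add ((√(q 0))⁻¹)) 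
      (fun t ht => (abs_le.1 (hbd t ht)).2) (by simp)
    linarith

/-! ### Derivatives of a self-concordant function along lines -/

namespace IsSelfConcordant

variable {M : ℝ} {D : Set E} {F : E → ℝ}

theorem contDiffAt (hF : IsSelfConcordant M D F) {x : E} (hx : x ∈ D) : ContDiffAt ℝ 3 F x :=
  hF.contDiffOn.contDiffAt (hF.isOpen_dom.mem_nhds hx)

theorem contDiffAt_grad (hF : IsSelfConcordant M D F) {x : E} (hx : x ∈ D) :
    ContDiffAt ℝ 2 (grad F) x :=
  (hF.contDiffAt hx).fderiv_right (by norm_num)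

theorem contDiffAt_hess (hF : IsSelfConcordant M D F) {x : E} (hx : x ∈ D) :
    ContDiffAt ℝ 1 (hess F) x :=
  (hF.contDiffAt_grad hx).fderiv_right (by norm_num)

theorem hasFDerivAt (hF : IsSelfConcordant M D F) {x : E} (hx : x ∈ D) :
    HasFDerivAt F (grad F x) x :=
  ((hF.contDiffAt hx).differentiableAt (by norm_num)).hasFDerivAt

theorem hasFDerivAt_grad (hF : IsSelfConcordant M D F) {x : E} (hx : x ∈ D) :
    HasFDerivAt (grad F) (hess F x) x :=
  ((hF.contDiffAt_grad hx).differentiableAt (by norm_num)).hasFDerivAt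

theorem hasFDerivAt_hess (hF : IsSelfConcordant M D F) {x : E} (hx : x ∈ D) :
    HasFDerivAt (hess F) (third F x) x :=
  ((hF.contDiffAt_hess hx).differentiableAt (by norm_num)).hasFDerivAt

theorem hess_comm (hF : IsSelfConcordant M D F) {x : E} (hx : x ∈ D) (u v : E) :
    hess F x u v = hess F x v u :=
  ((hF.contDiffAt hx).of_le (m := 2) (by norm_num)).isSymmSndFDerivAt (by simp) u v

theorem third_comm_left (hF : IsSelfConcordant M D F) {x : E} (hx : x ∈ D) (u v w : E) :
    third F x u v w = third F x v u w := by
  have := (hF.contDiffAt_grad hx).isSymmSndFDerivAt (by simp) u v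
  exact congrArg (fun l : E →L[ℝ] ℝ => l w) this

/-- The line through `x` in direction `h`. -/
theorem hasDerivAt_line (x h : E) (t : ℝ) : HasDerivAt (fun s : ℝ => x + s • h) h t := by
  simpa using ((hasDerivAt_id t).smul_const h).const_add x

theorem hasDerivAt_comp_line (hF : IsSelfConcordant M D F) {x h : E} {t : ℝ}
    (hx : x + t • h ∈ D) :
    HasDerivAt (fun s : ℝ => F (x + s • h)) (grad F (x + t • h) h) t :=
  (hF.hasFDerivAt hx).comp_hasDerivAt t (hasDerivAt_line x h t)

theorem hasDerivAt_grad_line (hF : IsSelfConcordant M D F) {x h : E} {t : ℝ}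
    (hx : x + t • h ∈ D) (u : E) :
    HasDerivAt (fun s : ℝ => grad F (x + s • h) u) (hess F (x + t • h) h u) t := by
  have := (hF.hasFDerivAt_grad hx).comp_hasDerivAt t (hasDerivAt_line x h t)
  simpa using this.clm_apply (hasDerivAt_const t u)

theorem hasDerivAt_hess_line (hF : IsSelfConcordant M D F) {x h : E} {t : ℝ}
    (hx : x + t • h ∈ D) (u v : E) :
    HasDerivAt (fun s : ℝ => hess F (x + s • h) u v) (third F (x + t • h) h u v) t := by
  have := (hF.hasFDerivAt_hess hx).comp_hasDerivAt t (hasDerivAt_line x h t)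
  simpa using (this.clm_apply (hasDerivAt_const t u)).clm_apply (hasDerivAt_const t v)

theorem third_comm_right (hF : IsSelfConcordant M D F) {x : E} (hx : x ∈ D) (u v w : E) :
    third F x u v w = third F x u w v := by
  have hx' : x + (0 : ℝ) • u ∈ D := by simpa using hx
  have h1 := hF.hasDerivAt_hess_line hx' v w
  have h2 := hF.hasDerivAt_hess_line hx' w v
  have hev : ∀ᶠ s : ℝ in 𝓝 0, x + s • u ∈ D :=
    (hasDerivAt_line x u 0).continuousAt.eventually (hF.isOpen_dom.mem_nhds hx')
  have h3 := h1.congr_of_eventuallyEq (f₁ := fun s : ℝ => hess F (x + s • u) w v)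
    (hev.mono fun s hs => hF.hess_comm hs w v)
  simpa using h3.unique h2

theorem line_mem (hF : IsSelfConcordant M D F) {x h : E} (hx : x ∈ D) {T t : ℝ}
    (hT : x + T • h ∈ D) (ht : t ∈ Icc 0 T) : x + t • h ∈ D := by
  rcases eq_or_ne T 0 with h0 | h0
  · have : t = 0 := le_antisymm (h0 ▸ ht.2) ht.1
    simpa [this] using hx
  have hTp : 0 < T := lt_of_le_of_ne (ht.1.trans ht.2) h0.symm
  have h1 : 0 ≤ 1 - t / T := sub_nonneg.2 ((div_le_one hTp).2 ht.2)
  have := hF.convexOn.1 hx hT h1 (div_nonneg ht.1 hTp.le) (by ring)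
  convert this using 1
  rw [smul_add, smul_smul, div_mul_cancel₀ _ h0, ← add_assoc, ← add_smul]
  simp

theorem hess_nonneg (hF : IsSelfConcordant M D F) {x : E} (hx : x ∈ D) (u : E) :
    0 ≤ hess F x u u := by
  have hx' : x + (0 : ℝ) • u ∈ D := by simpa using hx
  set S : Set ℝ := {s | x + s • u ∈ D} with hS
  have hconv : ConvexOn ℝ S (fun s : ℝ => F (x + s • u)) := by
    have := hF.convexOn.comp_affineMap (AffineMap.lineMap (k := ℝ) x (x + u))
    have e1 : AffineMap.lineMap (k := ℝ) x (x + u) ⁻¹' D = S := by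
      ext s; simp [hS, AffineMap.lineMap_apply, add_comm]
    have e2 : F ∘ AffineMap.lineMap (k := ℝ) x (x + u) = fun s : ℝ => F (x + s • u) := by
      ext s; simp [AffineMap.lineMap_apply, add_comm]
    rwa [e1, e2] at this
  have hmono := hconv.monotoneOn_deriv fun s hs => (hF.hasDerivAt_comp_line hs).differentiableAt
  have hmono' : MonotoneOn (fun s : ℝ => grad F (x + s • u) u) S := fun s hs t ht hst => by
    have := hmono hs ht hst
    rwa [(hF.hasDerivAt_comp_line hs).deriv, (hF.hasDerivAt_comp_line ht).deriv] at this
  have hopen : IsOpen S :=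
    hF.isOpen_dom.preimage (by fun_prop : Continuous fun s : ℝ => x + s • u)
  have h1 : 0 ≤ derivWithin (fun s : ℝ => grad F (x + s • u) u) S 0 := hmono'.derivWithin_nonneg
  rw [derivWithin_of_isOpen hopen hx', (hF.hasDerivAt_grad_line hx' u).deriv] at h1
  simpa using h1

end IsSelfConcordant

/-! ### Dikin ellipsoid, Hessian comparison and gradient estimates -/

/-- The local norm `‖h‖_x = ⟨∇²F(x) h, h⟩^{1/2}`. -/
noncomputable def localNorm (F : E → ℝ) (x h : E) : ℝ := √(hess F x h h)

theorem localNorm_nonneg (F : E → ℝ) (x h : E) : 0 ≤ localNorm F x h := Real.sqrt_nonneg _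

theorem localNorm_smul (F : E → ℝ) (x h : E) {t : ℝ} (ht : 0 ≤ t) :
    localNorm F x (t • h) = t * localNorm F x h := by
  have : hess F x (t • h) (t • h) = t ^ 2 * hess F x h h := by simp; ring
  rw [localNorm, this, Real.sqrt_mul (sq_nonneg t), Real.sqrt_sq ht, localNorm]

theorem localNorm_neg (F : E → ℝ) (x h : E) : localNorm F x (-h) = localNorm F x h := by
  simp [localNorm]

namespace IsSelfConcordant

variable {D : Set E} {F : E → ℝ}

theorem sq_localNorm (hF : IsSelfConcordant 1 D F) {x : E} (hx : x ∈ D) (h : E) :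
    localNorm F x h ^ 2 = hess F x h h :=
  Real.sq_sqrt (hF.hess_nonneg hx h)

theorem abs_third_le (hF : IsSelfConcordant 1 D F) {x : E} (hx : x ∈ D) (h : E) :
    |third F x h h h| ≤ 2 * (hess F x h h * √(hess F x h h)) := by
  have h0 := hF.hess_nonneg hx h
  have := hF.third_le x hx h
  have e : hess F x h h ^ (3 / 2 : ℝ) = hess F x h h * √(hess F x h h) := by
    rw [show (3 / 2 : ℝ) = 1 + 1 / 2 by norm_num,
      Real.rpow_add_of_nonneg h0 zero_le_one (by norm_num), Real.rpow_one, Real.sqrt_eq_rpow]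
  rwa [e, mul_one] at this

/-- The shift `δ` keeps the square root away from zero where the Hessian may degenerate, as is still
possible when the Dikin ellipsoid is treated. Once positive definiteness is known, `δ = 0` is used.
-/
theorem abs_inv_sqrt_hess_sub_le (hF : IsSelfConcordant 1 D F) {x h : E} (hx : x ∈ D) {T δ : ℝ}
    (hT : 0 ≤ T) (hxT : x + T • h ∈ D) (hδ : 0 ≤ δ)
    (hpos : ∀ t ∈ Icc 0 T, 0 < hess F (x + t • h) h h + δ) :
    |(√(hess F (x + T • h) h h + δ))⁻¹ - (√(hess F x h h + δ))⁻¹| ≤ T := by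
  have hmem : ∀ t ∈ Icc 0 T, x + t • h ∈ D := fun t ht => hF.line_mem hx hxT ht
  have := abs_inv_sqrt_sub_le (q := fun t => hess F (x + t • h) h h + δ) hT
    (fun t ht => (hF.hasDerivAt_hess_line (hmem t ht) h h).add_const δ) hpos fun t ht => ?_
  · simpa using this
  · have h0 := hF.hess_nonneg (hmem t ht) h
    refine (hF.abs_third_le (hmem t ht) h).trans ?_
    gcongr <;> linarith

/-- The open Dikin ellipsoid is contained in the domain. -/
theorem add_mem_of_hess_lt_one (hF : IsSelfConcordant 1 D F) {x h : E} (hx : x ∈ D)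
    (hh : hess F x h h < 1) : x + h ∈ D := by
  -- A bound on `F` along the part of the segment in the domain prevents the segment from leaving
  -- it: at height `K` the closed epigraph makes the set of admissible `t` closed. The choice of `δ`
  -- keeps `hess F x h h + δ < 1`, so the inverse square root starts at `1 + b` and stays above `b`
  -- over unit length.
  obtain ⟨K, hK⟩ : ∃ K : ℝ, ∀ t ∈ Icc (0 : ℝ) 1, x + t • h ∈ D → F (x + t • h) ≤ K := by
    have h0 := hF.hess_nonneg hx h
    set δ := (1 - hess F x h h) / 2 with hδ
    have hδpos : 0 < δ := by linarith
    have ha : 0 < √(hess F x h h + δ) := Real.sqrt_pos.2 (by linarith)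
    have ha1 : √(hess F x h h + δ) < 1 := by
      rw [Real.sqrt_lt' one_pos]; linarith
    set b := (√(hess F x h h + δ))⁻¹ - 1 with hb
    have hbpos : 0 < b := sub_pos.2 ((one_lt_inv₀ ha).2 ha1)
    have hbound : ∀ t ∈ Icc (0 : ℝ) 1, x + t • h ∈ D → hess F (x + t • h) h h ≤ (b⁻¹) ^ 2 := by
      intro t ht hxt
      have h1 := hF.abs_inv_sqrt_hess_sub_le hx ht.1 hxt hδpos.le fun s hs => by
        linarith [hF.hess_nonneg (hF.line_mem hx hxt hs) h]
      have h2 : b ≤ (√(hess F (x + t • h) h h + δ))⁻¹ := by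
        have := (abs_le.1 h1).1
        have := ht.2
        linarith
      have h3 : √(hess F (x + t • h) h h + δ) ≤ b⁻¹ := by
        rw [← inv_inv √(hess F (x + t • h) h h + δ)]
        exact inv_anti₀ hbpos h2
      have h4 := (Real.sqrt_le_left (inv_pos.2 hbpos).le).1 h3
      linarith
    have hB : 0 ≤ (b⁻¹) ^ 2 := sq_nonneg _
    refine ⟨F x + |grad F x h| + (b⁻¹) ^ 2, fun t ht hxt => ?_⟩
    have hg : ∀ s ∈ Icc 0 t, grad F (x + s • h) h ≤ grad F x h + (b⁻¹) ^ 2 := by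
      intro s hs
      have hxs := hF.line_mem hx hxt hs
      have := le_of_hasDerivAt_le (f := fun τ => grad F (x + τ • h) h)
        (g := fun τ => grad F x h + (b⁻¹) ^ 2 * τ) (g' := fun _ => (b⁻¹) ^ 2) hs.1
        (fun τ hτ => hF.hasDerivAt_grad_line (hF.line_mem hx hxs hτ) h)
        (fun τ _ => hasDerivAt_affine _ _ τ)
        (fun τ hτ => hbound τ ⟨hτ.1, hτ.2.trans (hs.2.trans ht.2)⟩ (hF.line_mem hx hxs hτ))
        (by simp)
      have hs1 : s ≤ 1 := hs.2.trans ht.2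
      nlinarith
    have := le_of_hasDerivAt_le (f := fun τ => F (x + τ • h))
      (g := fun τ => F x + (grad F x h + (b⁻¹) ^ 2) * τ)
      (g' := fun _ => grad F x h + (b⁻¹) ^ 2) ht.1
      (fun τ hτ => hF.hasDerivAt_comp_line (hF.line_mem hx hxt hτ))
      (fun τ _ => hasDerivAt_affine _ _ τ) hg (by simp)
    have h1 := le_abs_self (grad F x h)
    have h2 : (grad F x h + (b⁻¹) ^ 2) * t ≤ (|grad F x h| + (b⁻¹) ^ 2) * 1 := by
      have := abs_nonneg (grad F x h)
      refine mul_le_mul ?_ ht.2 ht.1 ?_ <;> linarith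
    linarith
  set S : Set ℝ := {t | x + t • h ∈ D} with hS
  have hcont : Continuous fun s : ℝ => x + s • h := by fun_prop
  have hclosed : IsClosed (S ∩ Icc 0 1) := by
    have e : S ∩ Icc 0 1 = (fun s : ℝ => (x + s • h, K)) ⁻¹' {p : E × ℝ | p.1 ∈ D ∧ F p.1 ≤ p.2}
        ∩ Icc 0 1 := by
      ext t
      simp only [hS, mem_inter_iff, mem_ofPred_eq, mem_preimage]
      constructor
      · rintro ⟨h1, h2⟩
        exact ⟨⟨h1, hK t h2 h1⟩, h2⟩
      · rintro ⟨h1, h2⟩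
        exact ⟨h1.1, h2⟩
    rw [e]
    exact (hF.isClosed_epigraph.preimage (hcont.prodMk continuous_const)).inter isClosed_Icc
  have := hclosed.Icc_subset_of_forall_mem_nhdsWithin (by simpa [hS] using hx)
    (fun t ht => mem_nhdsWithin_of_mem_nhds ((hF.isOpen_dom.preimage hcont).mem_nhds ht.1))
  simpa [hS] using this (right_mem_Icc.2 zero_le_one)

theorem add_mem_of_localNorm_lt_one (hF : IsSelfConcordant 1 D F) {x h : E} (hx : x ∈ D)
    (hh : localNorm F x h < 1) : x + h ∈ D := by
  refine hF.add_mem_of_hess_lt_one hx ?_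
  rw [← hF.sq_localNorm hx]
  exact pow_lt_one₀ (localNorm_nonneg F x h) hh two_ne_zero

/-- The Hessian is positive definite when the domain is bounded. -/
theorem hess_pos (hF : IsSelfConcordant 1 D F) (hb : Bornology.IsBounded D) {x : E} (hx : x ∈ D)
    {h : E} (hh : h ≠ 0) : 0 < hess F x h h := by
  refine lt_of_le_of_ne (hF.hess_nonneg hx h) fun h0 => ?_
  obtain ⟨R, hR⟩ := hb.exists_norm_le
  have hn : 0 < ‖h‖ := norm_pos_iff.2 hh
  -- In a degenerate direction the Dikin ellipsoid contains a whole line; `s` is large enough to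
  -- leave the ball of radius `R`.
  set s := (|R| + ‖x‖ + 1) / ‖h‖ with hs
  have h1 : x + s • h ∈ D := hF.add_mem_of_hess_lt_one hx (by simp [← h0])
  have h2 := hR _ h1
  have h3 : ‖s • h‖ = |R| + ‖x‖ + 1 := by
    rw [norm_smul, Real.norm_of_nonneg (by positivity), hs, div_mul_cancel₀ _ hn.ne']
  have h4 : ‖s • h‖ ≤ ‖x + s • h‖ + ‖x‖ := by
    have := norm_sub_le (x + s • h) x
    rwa [add_sub_cancel_left] at this
  linarith [le_abs_self R]

theorem localNorm_pos (hF : IsSelfConcordant 1 D F) (hb : Bornology.IsBounded D) {x : E}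
    (hx : x ∈ D) {h : E} (hh : h ≠ 0) : 0 < localNorm F x h :=
  Real.sqrt_pos.2 (hF.hess_pos hb hx hh)

theorem abs_third_apply_le (hF : IsSelfConcordant 1 D F) (hb : Bornology.IsBounded D) {x : E}
    (hx : x ∈ D) (h u : E) : |third F x h u u| ≤ 2 * localNorm F x h * hess F x u u := by
  refine abs_trilinear_le two_pos (fun u v w => hF.third_comm_left hx u v w)
    (fun u v w => hF.third_comm_right hx u v w) (fun u hu => hF.hess_pos hb hx hu)
    (fun u v => hF.hess_comm hx u v) (fun h => ?_) h u
  refine (hF.abs_third_le hx h).trans (le_of_eq ?_)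
  nth_rw 1 [← Real.sq_sqrt (hF.hess_nonneg hx h)]
  ring

theorem abs_inv_localNorm_sub_le (hF : IsSelfConcordant 1 D F) (hb : Bornology.IsBounded D)
    {x h : E} (hx : x ∈ D) (hh : h ≠ 0) {t : ℝ} (ht : 0 ≤ t) (hxt : x + t • h ∈ D) :
    |(localNorm F (x + t • h) h)⁻¹ - (localNorm F x h)⁻¹| ≤ t := by
  simpa [localNorm] using hF.abs_inv_sqrt_hess_sub_le hx ht hxt le_rfl
    fun s hs => by simpa using hF.hess_pos hb (hF.line_mem hx hxt hs) hh

theorem line_mem_of_localNorm_lt_one (hF : IsSelfConcordant 1 D F) {x h : E} (hx : x ∈ D)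
    (hh : localNorm F x h < 1) {t : ℝ} (ht : t ∈ Icc (0 : ℝ) 1) : x + t • h ∈ D :=
  hF.line_mem hx (T := 1) (by simpa using hF.add_mem_of_localNorm_lt_one hx hh) ht

theorem localNorm_line_le (hF : IsSelfConcordant 1 D F) (hb : Bornology.IsBounded D)
    {x h : E} (hx : x ∈ D) (hh : localNorm F x h < 1) {t : ℝ} (ht : t ∈ Icc (0 : ℝ) 1) :
    localNorm F (x + t • h) h ≤ localNorm F x h / (1 - localNorm F x h * t) := by
  rcases eq_or_ne h 0 with rfl | h0
  · simp [localNorm]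
  have hxt := hF.line_mem_of_localNorm_lt_one hx hh ht
  have hr := hF.localNorm_pos hb hx h0
  have hs := hF.localNorm_pos hb hxt h0
  have h1 := (abs_le.1 (hF.abs_inv_localNorm_sub_le hb hx h0 ht.1 hxt)).1
  set r := localNorm F x h
  set s := localNorm F (x + t • h) h
  have hrt : 0 < 1 - r * t := by nlinarith [ht.1, ht.2]
  have h2 : (1 - r * t) / r ≤ s⁻¹ := by
    have : (1 - r * t) / r = r⁻¹ - t := by field_simp
    linarith
  rw [← inv_inv s, ← inv_div]
  exact inv_anti₀ (by positivity) h2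

theorem le_localNorm_line (hF : IsSelfConcordant 1 D F) (hb : Bornology.IsBounded D)
    {x h : E} (hx : x ∈ D) {t : ℝ} (ht : 0 ≤ t) (hxt : x + t • h ∈ D) :
    localNorm F x h / (1 + localNorm F x h * t) ≤ localNorm F (x + t • h) h := by
  rcases eq_or_ne h 0 with rfl | h0
  · simp [localNorm]
  have hr := hF.localNorm_pos hb hx h0
  have hs := hF.localNorm_pos hb hxt h0
  have h1 := (abs_le.1 (hF.abs_inv_localNorm_sub_le hb hx h0 ht hxt)).2
  set r := localNorm F x h
  set s := localNorm F (x + t • h) h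
  have h2 : s⁻¹ ≤ (1 + r * t) / r := by
    have : (1 + r * t) / r = r⁻¹ + t := by field_simp
    linarith
  rw [← inv_inv s, ← inv_div]
  exact inv_anti₀ (by positivity) h2

/-- The function `hess F (x + t • h) u u * (1 - r t)²` is nonincreasing: the trilinear bound makes
the logarithmic derivative of the Hessian term at most `2 ‖h‖_{x + t h} ≤ 2r/(1 - r t)`. The lower
comparison `le_hess_add` divides by the same factor instead. -/
theorem hess_add_le (hF : IsSelfConcordant 1 D F) (hb : Bornology.IsBounded D)
    {x h : E} (hx : x ∈ D) (hh : localNorm F x h < 1) (u : E) :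
    hess F (x + h) u u * (1 - localNorm F x h) ^ 2 ≤ hess F x u u := by
  set r := localNorm F x h with hr
  have hr0 : 0 ≤ r := localNorm_nonneg F x h
  have := le_of_hasDerivAt_le (T := 1) (f := fun t => hess F (x + t • h) u u * (1 - r * t) ^ 2)
    (f' := fun t => third F (x + t • h) h u u * (1 - r * t) ^ 2
      + hess F (x + t • h) u u * (2 * (1 - r * t) * -r))
    (g := fun _ => hess F x u u) (g' := fun _ => 0) zero_le_one
    (fun t ht => ?_) (fun t _ => hasDerivAt_const _ _) (fun t ht => ?_) (by simp)
  · simpa using this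
  · have h1 := hF.hasDerivAt_hess_line (hF.line_mem_of_localNorm_lt_one hx hh ht) u u
    have h2 : HasDerivAt (fun t : ℝ => (1 - r * t) ^ 2) (2 * (1 - r * t) * -r) t := by
      simpa using ((hasDerivAt_mul_left r t).const_sub 1).fun_pow 2
    exact h1.mul h2
  · have hxt := hF.line_mem_of_localNorm_lt_one hx hh ht
    have h1 := (abs_le.1 (hF.abs_third_apply_le hb hxt h u)).2
    have h2 := hF.localNorm_line_le hb hx hh ht
    have h3 := hF.hess_nonneg hxt u
    have hrt : 0 < 1 - r * t := by nlinarith [ht.1, ht.2]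
    rw [← hr, le_div_iff₀ hrt] at h2
    calc _ ≤ (2 * localNorm F (x + t • h) h * hess F (x + t • h) u u) * (1 - r * t) ^ 2
          + hess F (x + t • h) u u * (2 * (1 - r * t) * -r) := by gcongr
      _ = 2 * hess F (x + t • h) u u * (1 - r * t) *
          (localNorm F (x + t • h) h * (1 - r * t) - r) := by ring
      _ ≤ 0 := mul_nonpos_of_nonneg_of_nonpos (by positivity) (by linarith)

theorem le_hess_add (hF : IsSelfConcordant 1 D F) (hb : Bornology.IsBounded D)
    {x h : E} (hx : x ∈ D) (hh : localNorm F x h < 1) (u : E) :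
    hess F x u u * (1 - localNorm F x h) ^ 2 ≤ hess F (x + h) u u := by
  set r := localNorm F x h with hr
  have hr0 : 0 ≤ r := localNorm_nonneg F x h
  have hrt : ∀ t ∈ Icc (0 : ℝ) 1, 0 < 1 - r * t := fun t ht => by nlinarith [ht.1, ht.2]
  have := le_of_hasDerivAt_le (T := 1) (g := fun t => hess F (x + t • h) u u / (1 - r * t) ^ 2)
    (g' := fun t => (third F (x + t • h) h u u * (1 - r * t) ^ 2
      - hess F (x + t • h) u u * (2 * (1 - r * t) * -r)) / ((1 - r * t) ^ 2) ^ 2)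
    (f := fun _ => hess F x u u) (f' := fun _ => 0) zero_le_one
    (fun t _ => hasDerivAt_const _ _) (fun t ht => ?_) (fun t ht => ?_) (by simp)
  · have h1 : 0 < 1 - r := by linarith
    rwa [one_smul, mul_one, le_div_iff₀ (by positivity)] at this
  · have h1 := hF.hasDerivAt_hess_line (hF.line_mem_of_localNorm_lt_one hx hh ht) u u
    have h2 : HasDerivAt (fun t : ℝ => (1 - r * t) ^ 2) (2 * (1 - r * t) * -r) t := by
      simpa using ((hasDerivAt_mul_left r t).const_sub 1).fun_pow 2
    exact h1.div h2 (pow_pos (hrt t ht) 2).ne'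
  · have hxt := hF.line_mem_of_localNorm_lt_one hx hh ht
    have h1 := (abs_le.1 (hF.abs_third_apply_le hb hxt h u)).1
    have h2 := hF.localNorm_line_le hb hx hh ht
    have h3 := hF.hess_nonneg hxt u
    have hrt := hrt t ht
    rw [← hr, le_div_iff₀ hrt] at h2
    refine div_nonneg ?_ (by positivity)
    calc (0 : ℝ) ≤ 2 * hess F (x + t • h) u u * (1 - r * t) *
          (r - localNorm F (x + t • h) h * (1 - r * t)) :=
          mul_nonneg (by positivity) (by linarith)
      _ = (-(2 * localNorm F (x + t • h) h * hess F (x + t • h) u u)) * (1 - r * t) ^ 2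
          - hess F (x + t • h) u u * (2 * (1 - r * t) * -r) := by ring
      _ ≤ _ := by gcongr

theorem localNorm_add_mul_le (hF : IsSelfConcordant 1 D F) (hb : Bornology.IsBounded D)
    {x h : E} (hx : x ∈ D) (hh : localNorm F x h < 1) (u : E) :
    localNorm F (x + h) u * (1 - localNorm F x h) ≤ localNorm F x u := by
  have := Real.sqrt_le_sqrt (hF.hess_add_le hb hx hh u)
  rwa [Real.sqrt_mul' _ (sq_nonneg _), Real.sqrt_sq (by linarith)] at this

theorem localNorm_mul_le_add (hF : IsSelfConcordant 1 D F) (hb : Bornology.IsBounded D)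
    {x h : E} (hx : x ∈ D) (hh : localNorm F x h < 1) (u : E) :
    localNorm F x u * (1 - localNorm F x h) ≤ localNorm F (x + h) u := by
  have := Real.sqrt_le_sqrt (hF.le_hess_add hb hx hh u)
  rwa [Real.sqrt_mul' _ (sq_nonneg _), Real.sqrt_sq (by linarith)] at this

/-- The Hessian at `x + t • h` lies between `a` and `a⁻¹` times the one at `x`, with `a = (1 - r
t)²`. Since `a + a⁻¹ ≥ 2`, both deviations are at most `a⁻¹ - 1`. The difference may be indefinite,
hence the polarization bound rather than Cauchy–Schwarz. -/
theorem abs_hess_line_sub_le (hF : IsSelfConcordant 1 D F) (hb : Bornology.IsBounded D)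
    {x h : E} (hx : x ∈ D) (hh : localNorm F x h < 1) {t : ℝ} (ht : t ∈ Icc (0 : ℝ) 1) (u : E) :
    |hess F (x + t • h) h u - hess F x h u| ≤
      (((1 - localNorm F x h * t) ^ 2)⁻¹ - 1) * localNorm F x h * localNorm F x u := by
  set r := localNorm F x h with hr
  have hr0 : 0 ≤ r := localNorm_nonneg F x h
  have hrt : 0 < 1 - r * t := by nlinarith [ht.1, ht.2]
  have hxt := hF.line_mem_of_localNorm_lt_one hx hh ht
  have hth : localNorm F x (t • h) = r * t := by rw [localNorm_smul F x h ht.1, mul_comm]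
  have hth1 : localNorm F x (t • h) < 1 := by linarith
  have := abs_apply_le_of_diag (G := hess F (x + t • h) - hess F x) (H := hess F x)
    (κ := ((1 - r * t) ^ 2)⁻¹ - 1) (fun u v => ?_) (fun u hu => hF.hess_pos hb hx hu)
    (fun u v => hF.hess_comm hx u v) (fun v => ?_) h u
  · simpa [hr, localNorm] using this
  · simp [hF.hess_comm hx u v, hF.hess_comm hxt u v]
  · have h1 := hF.hess_add_le hb hx hth1 v
    have h2 := hF.le_hess_add hb hx hth1 v
    rw [hth] at h1 h2
    have h0 := hF.hess_nonneg hx v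
    rw [← le_div_iff₀ (by positivity), div_eq_mul_inv] at h1
    have h3 : 2 ≤ (1 - r * t) ^ 2 + ((1 - r * t) ^ 2)⁻¹ := by
      have ha : 0 < (1 - r * t) ^ 2 := by positivity
      generalize (1 - r * t) ^ 2 = a at ha
      have : a + a⁻¹ - 2 = (a - 1) ^ 2 / a := by field_simp; ring
      have : 0 ≤ (a - 1) ^ 2 / a := by positivity
      linarith
    have h4 := mul_le_mul_of_nonneg_right h3 h0
    simp only [sub_apply]
    rw [abs_le]
    constructor <;> linarith

/-- The remainder in the linearization of the gradient, measured in the local dual norm. -/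
theorem abs_grad_add_sub_le (hF : IsSelfConcordant 1 D F) (hb : Bornology.IsBounded D)
    {x h : E} (hx : x ∈ D) (hh : localNorm F x h < 1) (u : E) :
    |grad F (x + h) u - grad F x u - hess F x h u| ≤
      localNorm F x h ^ 2 / (1 - localNorm F x h) * localNorm F x u := by
  have hr0 : 0 ≤ localNorm F x h := localNorm_nonneg F x h
  have hbd := fun t ht => hF.abs_hess_line_sub_le hb hx hh (t := t) ht u
  have hmem := fun t ht => hF.line_mem_of_localNorm_lt_one hx hh (t := t) ht
  generalize localNorm F x u = n at *
  generalize localNorm F x h = r at *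
  have hrt : ∀ t ∈ Icc (0 : ℝ) 1, 0 < 1 - r * t := fun t ht => by nlinarith [ht.1, ht.2]
  have hd : ∀ t ∈ Icc (0 : ℝ) 1, HasDerivAt
      (fun s => grad F (x + s • h) u - grad F x u - s * hess F x h u)
      (hess F (x + t • h) h u - hess F x h u) t := fun t ht => by
    simpa using ((hF.hasDerivAt_grad_line (hmem t ht) u).sub_const _).fun_sub
      ((hasDerivAt_id' t).mul_const (hess F x h u))
  -- The antiderivative of the Hessian bound; at `t = 1` it equals `r²/(1 - r) * n`.
  have hB : ∀ t ∈ Icc (0 : ℝ) 1, HasDerivAt (fun s => ((1 - r * s)⁻¹ - 1 - r * s) * n)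
      ((((1 - r * t) ^ 2)⁻¹ - 1) * r * n) t := fun t ht => by
    have h1 := hasDerivAt_mul_left r t
    have h2 := ((((h1.const_sub 1).inv (hrt t ht).ne').sub_const 1).sub h1).mul_const n
    refine h2.congr_deriv ?_
    rw [neg_neg]; ring
  have e : ((1 - r * 1)⁻¹ - 1 - r * 1) * n = r ^ 2 / (1 - r) * n := by
    have : 1 - r ≠ 0 := by linarith
    rw [mul_one]
    congr 1
    field_simp
    ring
  rw [← e, abs_le]
  constructor
  · have := le_of_hasDerivAt_le zero_le_one (fun t ht => (hB t ht).neg) hd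
      (fun t ht => (abs_le.1 (hbd t ht)).1) (by simp)
    simpa using this
  · have := le_of_hasDerivAt_le zero_le_one hd hB
      (fun t ht => (abs_le.1 (hbd t ht)).2) (by simp)
    simpa using this

/-- The quantitative strict monotonicity of the gradient. -/
theorem le_grad_add_sub (hF : IsSelfConcordant 1 D F) (hb : Bornology.IsBounded D)
    {x h : E} (hx : x ∈ D) (hxh : x + h ∈ D) :
    localNorm F x h ^ 2 / (1 + localNorm F x h) ≤ grad F (x + h) h - grad F x h := by
  have hxh' : x + (1 : ℝ) • h ∈ D := by simpa using hxh
  set r := localNorm F x h with hr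
  have hr0 : 0 ≤ r := localNorm_nonneg F x h
  have hmem : ∀ t ∈ Icc (0 : ℝ) 1, x + t • h ∈ D := fun t ht => hF.line_mem hx hxh' ht
  have hrt : ∀ t ∈ Icc (0 : ℝ) 1, 0 < 1 + r * t := fun t ht => by nlinarith [ht.1]
  -- The antiderivative of `(r/(1 + r t))²`, the lower bound for the squared local norm of `h` along
  -- the segment.
  have := le_of_hasDerivAt_le (T := 1) (f := fun s => r - r * (1 + r * s)⁻¹)
    (f' := fun t => (r / (1 + r * t)) ^ 2)
    (g := fun s => grad F (x + s • h) h - grad F x h) (g' := fun t => hess F (x + t • h) h h)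
    zero_le_one (fun t ht => ?_) (fun t ht => (hF.hasDerivAt_grad_line (hmem t ht) h).sub_const _)
    (fun t ht => ?_) (by simp)
  · have e : r - r * (1 + r * 1)⁻¹ = r ^ 2 / (1 + r) := by field_simp; ring
    rw [← e]
    simpa using this
  · have h1 := hasDerivAt_mul_left r t
    refine ((((h1.const_add 1).inv (hrt t ht).ne').const_mul r).const_sub r).congr_deriv ?_
    rw [div_pow]; ring
  · rw [← hF.sq_localNorm (hmem t ht)]
    have := hrt t ht
    exact pow_le_pow_left₀ (by positivity) (hF.le_localNorm_line hb hx ht.1 (hmem t ht)) 2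

end IsSelfConcordant

/-! ### Dual norms, Newton steps and minimizers of `F + t c` -/

theorem dualNorm_nonneg (F : E → ℝ) (x : E) (g : E →L[ℝ] ℝ) : 0 ≤ dualNorm F x g :=
  Real.sqrt_nonneg _

namespace IsSelfConcordant

variable {D : Set E} {F : E → ℝ}

section Dual

variable [FiniteDimensional ℝ E]

theorem hess_hessInv (hF : IsSelfConcordant 1 D F) (hb : Bornology.IsBounded D) {x : E}
    (hx : x ∈ D) (g : E →L[ℝ] ℝ) : hess F x (hessInv F x g) = g :=
  apply_inverse_of_pos (fun _ hu => hF.hess_pos hb hx hu) g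

theorem localNorm_hessInv (hF : IsSelfConcordant 1 D F) (hb : Bornology.IsBounded D) {x : E}
    (hx : x ∈ D) (g : E →L[ℝ] ℝ) : localNorm F x (hessInv F x g) = dualNorm F x g := by
  rw [localNorm, hF.hess_hessInv hb hx, dualNorm]

theorem abs_apply_le_dualNorm (hF : IsSelfConcordant 1 D F) (hb : Bornology.IsBounded D) {x : E}
    (hx : x ∈ D) (g : E →L[ℝ] ℝ) (u : E) : |g u| ≤ dualNorm F x g * localNorm F x u := by
  have := abs_apply_le_sqrt_mul_sqrt (fun _ hu => hF.hess_pos hb hx hu)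
    (fun u v => hF.hess_comm hx u v) (hessInv F x g) u
  rwa [hF.hess_hessInv hb hx] at this

/-- The converse of `abs_apply_le_dualNorm`: testing on `[∇²F(x)]⁻¹ g` attains the dual norm. Dual
norms are bounded through this variational form from here on. -/
theorem dualNorm_le (hF : IsSelfConcordant 1 D F) (hb : Bornology.IsBounded D) {x : E}
    (hx : x ∈ D) {g : E →L[ℝ] ℝ} {K : ℝ} (hK : 0 ≤ K) (h : ∀ u, g u ≤ K * localNorm F x u) :
    dualNorm F x g ≤ K := by
  have h1 := h (hessInv F x g)
  have h2 := hF.sq_localNorm hx (hessInv F x g)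
  rw [hF.hess_hessInv hb hx, hF.localNorm_hessInv hb hx] at h2
  rw [hF.localNorm_hessInv hb hx, ← h2] at h1
  rcases (dualNorm_nonneg F x g).eq_or_lt with h0 | h0
  · rwa [← h0]
  · exact le_of_mul_le_mul_right (by rwa [← sq]) h0

theorem dualNorm_pos (hF : IsSelfConcordant 1 D F) (hb : Bornology.IsBounded D) {x : E}
    (hx : x ∈ D) {g : E →L[ℝ] ℝ} (hg : g ≠ 0) : 0 < dualNorm F x g := by
  rw [← hF.localNorm_hessInv hb hx]
  refine hF.localNorm_pos hb hx fun h => hg ?_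
  rw [← hF.hess_hessInv hb hx g, h, map_zero]

/-- The dual norm at a point of the Dikin ellipsoid, against the dual norm at its center. -/
theorem dualNorm_le_of_localNorm (hF : IsSelfConcordant 1 D F) (hb : Bornology.IsBounded D)
    {x h : E} (hx : x ∈ D) (hh : localNorm F x h < 1) (g : E →L[ℝ] ℝ) :
    dualNorm F x g * (1 - localNorm F x h) ≤ dualNorm F (x + h) g := by
  have hxh := hF.add_mem_of_localNorm_lt_one hx hh
  have hr : 0 < 1 - localNorm F x h := by linarith
  rw [← le_div_iff₀ hr]
  refine hF.dualNorm_le hb hx (div_nonneg (dualNorm_nonneg _ _ _) hr.le) fun u => ?_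
  have h1 := (le_abs_self _).trans (hF.abs_apply_le_dualNorm hb hxh g u)
  have h2 := hF.localNorm_add_mul_le hb hx hh u
  rw [← le_div_iff₀ hr] at h2
  calc g u ≤ dualNorm F (x + h) g * (localNorm F x u / (1 - localNorm F x h)) :=
        h1.trans (mul_le_mul_of_nonneg_left h2 (dualNorm_nonneg _ _ _))
    _ = _ := by ring

/-- The change of the gradient of `F + t c` along a step `h`, with predicted residual `g`. -/
theorem dualNorm_grad_add_le (hF : IsSelfConcordant 1 D F) (hb : Bornology.IsBounded D)
    {x h : E} (hx : x ∈ D) {r : ℝ} (hhr : localNorm F x h ≤ r) (hr1 : r < 1) {t : ℝ}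
    {c g : E →L[ℝ] ℝ} (hg : grad F x + hess F x h + t • c = g) {b : ℝ}
    (hgb : dualNorm F x g ≤ b) :
    x + h ∈ D ∧ dualNorm F (x + h) (grad F (x + h) + t • c) ≤ (b + r ^ 2 / (1 - r)) / (1 - r) := by
  have hh := hhr.trans_lt hr1
  have hxh := hF.add_mem_of_localNorm_lt_one hx hh
  have h0 := localNorm_nonneg F x h
  have hb0 : 0 ≤ b := (dualNorm_nonneg _ _ _).trans hgb
  have hr : 0 < 1 - r := by linarith
  have hr' : 0 < 1 - localNorm F x h := by linarith
  refine ⟨hxh, hF.dualNorm_le hb hxh (by positivity) fun u => ?_⟩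
  have h1 := (abs_le.1 (hF.abs_grad_add_sub_le hb hx hh u)).2
  have h2 := (le_abs_self _).trans (hF.abs_apply_le_dualNorm hb hx g u)
  have h3 := hF.localNorm_mul_le_add hb hx hh u
  have hu := localNorm_nonneg F x u
  have e : (grad F (x + h) + t • c) u
      = (grad F (x + h) u - grad F x u - hess F x h u) + g u := by
    rw [← hg]; simp only [add_apply]; ring
  rw [← le_div_iff₀ hr'] at h3
  calc (grad F (x + h) + t • c) u
      ≤ localNorm F x h ^ 2 / (1 - localNorm F x h) * localNorm F x u
        + dualNorm F x g * localNorm F x u := by rw [e]; exact add_le_add h1 h2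
    _ ≤ r ^ 2 / (1 - r) * localNorm F x u + b * localNorm F x u := by gcongr
    _ = (b + r ^ 2 / (1 - r)) * localNorm F x u := by ring
    _ ≤ (b + r ^ 2 / (1 - r)) * (localNorm F (x + h) u / (1 - r)) := by
      refine mul_le_mul_of_nonneg_left (h3.trans ?_) (by positivity)
      exact div_le_div_of_nonneg_left (localNorm_nonneg _ _ _) hr (by linarith)
    _ = _ := by ring

/-- One Newton step for `F + t c` squares the centering error. -/
theorem newton_step (hF : IsSelfConcordant 1 D F) (hb : Bornology.IsBounded D)
    {x : E} (hx : x ∈ D) {t : ℝ} {c : E →L[ℝ] ℝ} {l : ℝ} (hl : l < 1)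
    (hgl : dualNorm F x (grad F x + t • c) ≤ l) :
    x - hessInv F x (grad F x + t • c) ∈ D ∧
      dualNorm F (x - hessInv F x (grad F x + t • c))
        (grad F (x - hessInv F x (grad F x + t • c)) + t • c) ≤ (l / (1 - l)) ^ 2 := by
  have h1 : localNorm F x (-hessInv F x (grad F x + t • c)) ≤ l := by
    rwa [localNorm_neg, hF.localNorm_hessInv hb hx]
  have := hF.dualNorm_grad_add_le hb hx h1 hl (t := t) (c := c) (g := 0)
    (by rw [map_neg, hF.hess_hessInv hb hx]; abel) (b := 0) (by simp [dualNorm])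
  rw [← sub_eq_add_neg] at this
  refine ⟨this.1, this.2.trans (le_of_eq ?_)⟩
  rw [zero_add, div_div, div_pow, sq (1 - l)]

/-- The distance to an exact minimizer of `F + t c` in terms of the centering error. -/
theorem localNorm_sub_le (hF : IsSelfConcordant 1 D F) (hb : Bornology.IsBounded D)
    {x z : E} (hx : x ∈ D) (hz : z ∈ D) {t : ℝ} {c : E →L[ℝ] ℝ} (hzt : grad F z + t • c = 0)
    {b : ℝ} (hb1 : b < 1) (hxb : dualNorm F x (grad F x + t • c) ≤ b) :
    localNorm F x (z - x) ≤ b / (1 - b) := by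
  have h1 := hF.le_grad_add_sub hb hx (h := z - x) (by simpa using hz)
  rw [add_sub_cancel] at h1
  have h2 := (abs_le.1 (hF.abs_apply_le_dualNorm hb hx (grad F x + t • c) (z - x))).1
  have h3 : grad F z (z - x) = -(t * c (z - x)) := by
    have := congrArg (fun l : E →L[ℝ] ℝ => l (z - x)) hzt
    simp only [add_apply, smul_apply, smul_eq_mul, zero_apply] at this
    linarith
  simp only [add_apply, smul_apply, smul_eq_mul] at h2
  have hr0 := localNorm_nonneg F x (z - x)
  set r := localNorm F x (z - x)
  -- Strong monotonicity bounds `⟨∇F(z) - ∇F(x), z - x⟩` below; optimality of `z` makes it minus the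
  -- residual at `x` applied to `z - x`, so at most `b r`.
  have h4 : r ^ 2 / (1 + r) ≤ b * r := by
    have := mul_le_mul_of_nonneg_right hxb hr0
    linarith
  rw [div_le_iff₀ (by linarith)] at h4
  rw [le_div_iff₀ (by linarith)]
  rcases hr0.eq_or_lt with h0 | h0
  · rw [← h0]; simpa using (dualNorm_nonneg _ _ _).trans hxb
  · refine le_of_mul_le_mul_left ?_ h0
    nlinarith

end Dual

/-- The gradient of `F` vanishes, up to the linear term, at a minimizer of `F + t c`. -/
theorem grad_add_eq_zero (hF : IsSelfConcordant 1 D F) {z : E} (hz : z ∈ D) {t : ℝ}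
    {c : E →L[ℝ] ℝ} (hmin : IsMinOn (fun x => F x + t * c x) D z) : grad F z + t • c = 0 :=
  (hmin.isLocalMin (hF.isOpen_dom.mem_nhds hz)).hasFDerivAt_eq_zero
    ((hF.hasFDerivAt hz).add (c.hasFDerivAt.const_mul t))

/-- The sublevel set through `x₀` is the preimage of the closed epigraph under a continuous map, so
it is closed in `E`, not just in `D`. Being bounded, it is compact. -/
theorem exists_isMinOn (hF : IsSelfConcordant 1 D F) [FiniteDimensional ℝ E]
    (hb : Bornology.IsBounded D) {x₀ : E} (hx₀ : x₀ ∈ D) (t : ℝ) (c : E →L[ℝ] ℝ) :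
    ∃ z ∈ D, IsMinOn (fun x => F x + t * c x) D z := by
  set K := F x₀ + t * c x₀
  set S : Set E := {x | x ∈ D ∧ F x ≤ K - t * c x} with hS
  have hclosed : IsClosed S :=
    hF.isClosed_epigraph.preimage
      (by fun_prop : Continuous fun x : E => (x, K - t * c x))
  have : ProperSpace E := FiniteDimensional.proper ℝ E
  have hcomp : IsCompact S :=
    Metric.isCompact_of_isClosed_isBounded hclosed (hb.subset fun x hx => hx.1)
  have hcont : ContinuousOn (fun x => F x + t * c x) S :=
    (hF.contDiffOn.continuousOn.mono fun x hx => hx.1).add (by fun_prop)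
  obtain ⟨z, hz, hmin⟩ := hcomp.exists_isMinOn ⟨x₀, hx₀, by simp [K]⟩ hcont
  refine ⟨z, hz.1, fun x hx => ?_⟩
  by_cases h : F x ≤ K - t * c x
  · exact hmin ⟨hx, h⟩
  · have h1 : F z + t * c z ≤ F x₀ + t * c x₀ := hmin ⟨hx₀, by simp [K]⟩
    simp only [mem_ofPred_eq]
    have : K = F x₀ + t * c x₀ := rfl
    linarith

end IsSelfConcordant

/-! ### Barrier inequalities and complexity of path following -/

namespace IsSelfConcordantBarrier

variable {D : Set E} {F : E → ℝ} {ν : ℝ}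

theorem nonneg (hF : IsSelfConcordantBarrier ν D F) {x : E} (hx : x ∈ D) : 0 ≤ ν := by
  simpa using hF.barrier x hx 0

/-- Optimize the barrier inequality over multiples of `u`. If the quadratic term vanishes, the
remaining linear term is bounded above only when it is zero. -/
theorem sq_grad_le (hF : IsSelfConcordantBarrier ν D F) {x : E} (hx : x ∈ D) (u : E) :
    grad F x u ^ 2 ≤ ν * hess F x u u := by
  have h := fun s : ℝ => hF.barrier x hx (s • u)
  simp only [map_smul, smul_apply, smul_eq_mul] at h
  have hq := hF.selfConcordant.hess_nonneg hx u
  rcases hq.eq_or_lt with h0 | h0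
  · rw [← h0] at h ⊢
    by_contra hc
    have hg : grad F x u ≠ 0 := by
      rintro h1; simp [h1] at hc
    have h1 := h ((ν + 1) / (2 * grad F x u))
    have e : 2 * ((ν + 1) / (2 * grad F x u) * grad F x u) = ν + 1 := by field_simp
    rw [e] at h1
    linarith
  · have h1 := h (grad F x u / hess F x u u)
    have e : 2 * (grad F x u / hess F x u u * grad F x u) - grad F x u / hess F x u u *
        (grad F x u / hess F x u u * hess F x u u) = grad F x u ^ 2 / hess F x u u := by
      field_simp; ring
    rw [e, div_le_iff₀ h0] at h1
    exact h1

theorem abs_grad_le (hF : IsSelfConcordantBarrier ν D F) {x : E} (hx : x ∈ D) (u : E) :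
    |grad F x u| ≤ √ν * localNorm F x u := by
  rw [localNorm, ← Real.sqrt_mul (hF.nonneg hx), ← Real.sqrt_sq_eq_abs]
  exact Real.sqrt_le_sqrt (hF.sq_grad_le hx u)

/-- The slope `φ(s) = ⟨∇F(x + s h), h⟩` satisfies `ν φ' ≥ φ²`, so `-ν/φ` grows at rate at least one.
A positive slope must therefore blow up by time `ν/φ(0)`. -/
theorem grad_mul_le (hF : IsSelfConcordantBarrier ν D F) {x h : E} (hx : x ∈ D) {T : ℝ}
    (hT : 0 ≤ T) (hxT : x + T • h ∈ D) : grad F x h * T ≤ ν := by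
  rcases le_or_gt (grad F x h) 0 with h0 | h0
  · exact (mul_nonpos_of_nonpos_of_nonneg h0 hT).trans (hF.nonneg hx)
  have hsc := hF.selfConcordant
  have hmem : ∀ t ∈ Icc 0 T, x + t • h ∈ D := fun t ht => hsc.line_mem hx hxT ht
  have hpos : ∀ t ∈ Icc 0 T, 0 < grad F (x + t • h) h := fun t ht => by
    have := le_of_hasDerivAt_le (f := fun _ => grad F x h) (f' := fun _ => 0)
      (g := fun s => grad F (x + s • h) h) ht.1 (fun s _ => hasDerivAt_const _ _)
      (fun s hs => hsc.hasDerivAt_grad_line (hmem s ⟨hs.1, hs.2.trans ht.2⟩) h)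
      (fun s hs => hsc.hess_nonneg (hmem s ⟨hs.1, hs.2.trans ht.2⟩) h) (by simp)
    exact h0.trans_le this
  have := le_of_hasDerivAt_le (f := fun s => 0 + 1 * s) (f' := fun _ => 1)
    (g := fun s => ν * (grad F x h)⁻¹ - ν * (grad F (x + s • h) h)⁻¹) hT
    (fun s _ => hasDerivAt_affine _ _ s)
    (fun s hs => (((hsc.hasDerivAt_grad_line (hmem s hs) h).fun_inv
      (hpos s hs).ne').const_mul ν).const_sub _) (fun s hs => ?_) (by simp)
  · have h1 := hpos T ⟨hT, le_rfl⟩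
    have h2 : 0 ≤ ν * (grad F (x + T • h) h)⁻¹ := mul_nonneg (hF.nonneg hx) (inv_pos.2 h1).le
    have h3 : T ≤ ν * (grad F x h)⁻¹ := by linarith
    rwa [← div_eq_mul_inv, le_div_iff₀ h0, mul_comm] at h3
  · have h1 := hF.sq_grad_le (hmem s hs) h
    have h2 := hpos s hs
    rw [neg_div, mul_neg, neg_neg, ← mul_div_assoc, le_div_iff₀ (by positivity)]
    linarith

theorem grad_sub_le (hF : IsSelfConcordantBarrier ν D F) {x y : E} (hx : x ∈ D)
    (hy : y ∈ closure D) : grad F x (y - x) ≤ ν := by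
  have hlim : Tendsto (fun T : ℝ => grad F x (y - x) * T) (𝓝[<] 1) (𝓝 (grad F x (y - x) * 1)) :=
    ((continuous_const.mul continuous_id).tendsto 1).mono_left nhdsWithin_le_nhds
  rw [mul_one] at hlim
  refine le_of_tendsto hlim ?_
  filter_upwards [Ioo_mem_nhdsLT (zero_lt_one' ℝ)] with T hT
  refine hF.grad_mul_le hx hT.1.le ?_
  have h1 := hF.selfConcordant.convexOn.1.openSegment_interior_closure_subset_interior
    (x := x) (y := y) (by rwa [hF.selfConcordant.isOpen_dom.interior_eq]) hy
  rw [hF.selfConcordant.isOpen_dom.interior_eq] at h1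
  refine h1 ⟨1 - T, T, by linarith [hT.2], hT.1, by ring, ?_⟩
  rw [smul_sub, sub_smul, one_smul]; abel

/-- Take `h` of local norm `1/2` at the critical point `z`. Monotonicity makes the slope at `z + h`
at least `(1/4)/(3/2) = 1/6`, while the barrier bounds it by `√ν` times the new local norm of `h`,
which is at most `1`. -/
theorem one_div_six_le_sqrt (hF : IsSelfConcordantBarrier ν D F) (hb : Bornology.IsBounded D)
    [Nontrivial E] {z : E} (hz : z ∈ D) (hmin : grad F z = 0) : 1 / 6 ≤ √ν := by
  have hsc := hF.selfConcordant
  obtain ⟨u, hu⟩ := exists_ne (0 : E)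
  have hpos := hsc.localNorm_pos hb hz hu
  obtain ⟨h, hh⟩ : ∃ h, localNorm F z h = 1 / 2 := by
    refine ⟨(1 / 2 / localNorm F z u) • u, ?_⟩
    rw [localNorm_smul _ _ _ (by positivity), div_mul_cancel₀ _ hpos.ne']
  have hh1 : localNorm F z h < 1 := by rw [hh]; norm_num
  have hzh := hsc.add_mem_of_localNorm_lt_one hz hh1
  have h1 := hsc.le_grad_add_sub hb hz hzh
  have h2 := (le_abs_self _).trans (hF.abs_grad_le hzh h)
  have h3 := hsc.localNorm_add_mul_le hb hz hh1 h
  rw [hmin, hh] at h1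
  rw [hh] at h3
  simp only [zero_apply, sub_zero] at h1
  have h4 : localNorm F (z + h) h ≤ 1 := by linarith
  have h5 := mul_le_mul_of_nonneg_left h4 (Real.sqrt_nonneg ν)
  norm_num at h1
  linarith

/-- The analytic center minimizes `F`, hence is a critical point. -/
theorem grad_analyticCenter (hF : IsSelfConcordantBarrier ν D F) {xF : E}
    (hxF : IsAnalyticCenter D F xF) : grad F xF = 0 := by
  simpa using hF.selfConcordant.grad_add_eq_zero hxF.1 (t := 0) (c := 0) (by simpa using hxF.2)

theorem one_div_six_le_sqrt_of_ne_zero (hF : IsSelfConcordantBarrier ν D F)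
    (hb : Bornology.IsBounded D) {c : E →L[ℝ] ℝ} (hc : c ≠ 0) {xF : E}
    (hxF : IsAnalyticCenter D F xF) : 1 / 6 ≤ √ν := by
  have : Nontrivial E := by
    by_contra h
    rw [not_nontrivial_iff_subsingleton] at h
    exact hc (ContinuousLinearMap.ext fun v => by rw [Subsingleton.elim v 0]; simp)
  exact hF.one_div_six_le_sqrt hb hxF.1 (hF.grad_analyticCenter hxF)

variable [FiniteDimensional ℝ E]

/-- The duality gap at an approximately centered point. -/
theorem gap_le (hF : IsSelfConcordantBarrier ν D F) (hb : Bornology.IsBounded D) {x y : E}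
    (hx : x ∈ D) (hy : y ∈ closure D) {t : ℝ} {c : E →L[ℝ] ℝ} {b : ℝ} (hb1 : b < 1)
    (hxb : dualNorm F x (grad F x + t • c) ≤ b) :
    t * (c x - c y) ≤ ν + (b + √ν) * (b / (1 - b)) := by
  have hsc := hF.selfConcordant
  -- Split the gap at the exact minimizer `z`: from `z` to `y` it costs at most `ν`, and from `x` to
  -- `z` at most `(b + √ν)` times the local distance `b/(1 - b)`.
  obtain ⟨z, hz, hmin⟩ := hsc.exists_isMinOn hb hx t c
  have hgz := hsc.grad_add_eq_zero hz hmin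
  have hr := hsc.localNorm_sub_le hb hx hz hgz hb1 hxb
  have hb0 : 0 ≤ b := (dualNorm_nonneg _ _ _).trans hxb
  have h1 := hF.grad_sub_le hz hy
  have h2 : grad F z (y - z) = -(t * c (y - z)) := by
    have := congrArg (fun l : E →L[ℝ] ℝ => l (y - z)) hgz
    simp only [add_apply, smul_apply, smul_eq_mul, zero_apply] at this
    linarith
  have h3 := (abs_le.1 (hsc.abs_apply_le_dualNorm hb hx (grad F x + t • c) (z - x))).1
  simp only [add_apply, smul_apply, smul_eq_mul] at h3
  have h4 := (abs_le.1 (hF.abs_grad_le hx (z - x))).2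
  have h5 : dualNorm F x (grad F x + t • c) * localNorm F x (z - x) ≤ b * (b / (1 - b)) :=
    mul_le_mul hxb hr (localNorm_nonneg _ _ _) hb0
  have h6 : √ν * localNorm F x (z - x) ≤ √ν * (b / (1 - b)) :=
    mul_le_mul_of_nonneg_left hr (Real.sqrt_nonneg _)
  simp only [map_sub] at *
  linarith

/-- The dual norm of the cost at an approximately centered point. -/
theorem mul_dualNorm_le (hF : IsSelfConcordantBarrier ν D F) (hb : Bornology.IsBounded D) {x : E}
    (hx : x ∈ D) {t : ℝ} (ht : 0 < t) {c : E →L[ℝ] ℝ} {b : ℝ}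
    (hxb : dualNorm F x (grad F x + t • c) ≤ b) :
    t * dualNorm F x c ≤ b + √ν := by
  have hsc := hF.selfConcordant
  have hb0 : 0 ≤ b := (dualNorm_nonneg _ _ _).trans hxb
  rw [mul_comm, ← le_div_iff₀ ht]
  refine hsc.dualNorm_le hb hx (by positivity) fun u => ?_
  have h3 := (abs_le.1 (hsc.abs_apply_le_dualNorm hb hx (grad F x + t • c) u)).2
  simp only [add_apply, smul_apply, smul_eq_mul] at h3
  have h4 := (abs_le.1 (hF.abs_grad_le hx u)).1
  have h5 := mul_le_mul_of_nonneg_right hxb (localNorm_nonneg F x u)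
  rw [div_mul_eq_mul_div, le_div_iff₀ ht]
  linarith

/-- Centering error `1/9` at `t = 0` puts the analytic center within local distance `(1/9)/(8/9) =
1/8`, and the norms differ by the factor `1/(1 - 1/8)`. -/
theorem dualNorm_le_analyticCenter (hF : IsSelfConcordantBarrier ν D F)
    (hb : Bornology.IsBounded D) {xF x : E} (hxF : IsAnalyticCenter D F xF) (hx : x ∈ D)
    (c : E →L[ℝ] ℝ) (hcen : dualNorm F x (grad F x) ≤ 1 / 9) :
    dualNorm F x c ≤ 8 / 7 * dualNorm F xF c := by
  have hsc := hF.selfConcordant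
  have h1 := hsc.localNorm_sub_le hb hx hxF.1 (t := 0) (c := 0) (b := 1 / 9)
    (by simpa using hF.grad_analyticCenter hxF) (by norm_num) (by simpa using hcen)
  norm_num at h1
  have h2 := hsc.dualNorm_le_of_localNorm hb hx (h1.trans_lt (by norm_num)) c
  rw [add_sub_cancel] at h2
  have h3 := mul_le_mul_of_nonneg_left h1 (dualNorm_nonneg F x c)
  linarith

/-- The complexity analysis of any sequence of approximately centered points along which the
penalty parameter grows by `γ / ‖c‖*_x` at each step. -/
theorem abs_sub_le_of_centered (hF : IsSelfConcordantBarrier ν D F) (hb : Bornology.IsBounded D)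
    {c : E →L[ℝ] ℝ} (hc : c ≠ 0) {xF xstar : E} (hxF : IsAnalyticCenter D F xF)
    (hxs : xstar ∈ closure D) (hmin : IsMinOn c (closure D) xstar) {ε : ℝ} (hε : 0 < ε)
    {b γ : ℝ} (hb9 : b ≤ 1 / 9) (hbγ : b ≤ γ) (hγ : 5 / 36 ≤ γ)
    {t : ℕ → ℝ} {x : ℕ → E} (ht0 : t 0 = 0)
    (hx : ∀ k, x k ∈ D) (hcen : ∀ k, dualNorm F (x k) (grad F (x k) + t k • c) ≤ b)
    (hstep : ∀ k, t (k + 1) = t k + γ / dualNorm F (x k) c) {N : ℕ}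
    (hN : √ν / γ * logFactor ν F c xF ε + 300 * (√ν + logFactor ν F c xF ε) ≤ N) :
    x N ∈ closure D ∧ |c (x N) - c xstar| ≤ ε := by
  have hsc := hF.selfConcordant
  have hs := hF.one_div_six_le_sqrt_of_ne_zero hb hc hxF
  have hν : √ν ^ 2 = ν := Real.sq_sqrt (hF.nonneg hxF.1)
  have hnF := hsc.dualNorm_pos hb hxF.1 hc
  have hb0 : 0 ≤ b := (dualNorm_nonneg _ _ _).trans (hcen 0)
  have hL1 : 1 ≤ logFactor ν F c xF ε := le_max_left _ _
  have hL2 : Real.log (ν * dualNorm F xF c / ε) ≤ logFactor ν F c xF ε := le_max_right _ _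
  set L := logFactor ν F c xF ε
  set s := √ν
  set n := dualNorm F xF c
  have hγ0 : 0 < γ := by linarith
  have hνpos : 0 < ν := by rw [← hν]; positivity
  obtain ⟨k, rfl⟩ : ∃ k, N = k + 1 := by
    refine Nat.exists_eq_succ_of_ne_zero ?_
    rintro rfl
    have : 0 ≤ s / γ * L := by positivity
    rw [Nat.cast_zero] at hN
    linarith
  set u := γ / (b + s) with hu
  have hbs : 0 < b + s := by linarith
  have hu0 : 0 < u := by positivity
  -- Geometric growth cannot start at `t 0 = 0`, so the first step is treated apart: `t 1 ≥
  -- (5/36)(7/8)/n ≥ 1/(10 n)`.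
  have ht1 : 1 / (10 * n) ≤ t 1 := by
    have h1 := hF.dualNorm_le_analyticCenter hb hxF (hx 0) c
      (by simpa [ht0] using (hcen 0).trans hb9)
    have h2 := hsc.dualNorm_pos hb (hx 0) hc
    rw [hstep 0, ht0, zero_add, div_le_div_iff₀ (by positivity) h2]
    nlinarith
  have hgrow : ∀ k, 1 / (10 * n) * (1 + u) ^ k ≤ t (k + 1) := by
    intro k
    induction k with
    | zero => simpa using ht1
    | succ k ih =>
      have hpos : 0 < t (k + 1) := lt_of_lt_of_le (by positivity) ih
      have h1 := hF.mul_dualNorm_le hb (hx (k + 1)) hpos (hcen (k + 1))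
      have h2 := hsc.dualNorm_pos hb (hx (k + 1)) hc
      have h3 : u * t (k + 1) ≤ γ / dualNorm F (x (k + 1)) c := by
        rw [le_div_iff₀ h2, hu, mul_assoc, div_mul_eq_mul_div, div_le_iff₀ hbs]
        exact mul_le_mul_of_nonneg_left h1 hγ0.le
      rw [hstep (k + 1), pow_succ]
      nlinarith
  -- The factor `30` cancels the `10` in the bound on `t 1` and leaves `t ε ≥ 3ν`, enough for a gap
  -- of `ν + 2ν`. The leading term `√ν L/γ` comes from `log (1 + u) ≥ u/(1 + u) = γ/(γ + b + √ν)`;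
  -- the term with `300` pays for the rest.
  have hpow : 30 * (ν * n / ε) ≤ (1 + u) ^ k := by
    have h1 : 0 < ν * n / ε := by positivity
    have h2 : (1 + u) ^ k = Real.exp (k * Real.log (1 + u)) := by
      rw [Real.exp_nat_mul, Real.exp_log (by linarith)]
    have h3 : γ / (γ + b + s) ≤ Real.log (1 + u) := by
      have := Real.one_sub_inv_le_log_of_pos (show 0 < 1 + u by linarith)
      have e : γ / (γ + b + s) = 1 - (1 + u)⁻¹ := by
        rw [hu]; field_simp; ring
      rwa [e]
    have h4 : 29 + L ≤ k * Real.log (1 + u) := by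
      refine le_trans ?_ (mul_le_mul_of_nonneg_left h3 (Nat.cast_nonneg k))
      rw [← mul_div_assoc, le_div_iff₀ (by linarith)]
      have h5 : (s / γ * L + 300 * (s + L)) * γ ≤ (k + 1) * γ := by
        push_cast at hN
        exact mul_le_mul_of_nonneg_right hN hγ0.le
      have e : (s / γ * L + 300 * (s + L)) * γ = s * L + 300 * (γ * s) + 300 * (γ * L) := by
        field_simp
        ring
      rw [e] at h5
      have h6 : 5 / 36 * s ≤ γ * s := by gcongr
      have h7 : γ * 1 ≤ γ * L := by gcongr
      have h8 : b * L ≤ γ * L := by gcongr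
      nlinarith
    calc 30 * (ν * n / ε) ≤ Real.exp 29 * Real.exp (Real.log (ν * n / ε)) := by
          rw [Real.exp_log h1]
          have := Real.add_one_le_exp (29 : ℝ)
          gcongr
          linarith
      _ = Real.exp (29 + Real.log (ν * n / ε)) := by rw [Real.exp_add]
      _ ≤ (1 + u) ^ k := by rw [h2]; exact Real.exp_le_exp.2 (by linarith)
  have htN : 3 * ν ≤ t (k + 1) * ε := by
    have h1 : 1 / (10 * n) * (30 * (ν * n / ε)) ≤ t (k + 1) :=
      (mul_le_mul_of_nonneg_left hpow (by positivity)).trans (hgrow k)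
    have e : 1 / (10 * n) * (30 * (ν * n / ε)) = 3 * ν / ε := by field_simp; norm_num
    rwa [e, div_le_iff₀ hε] at h1
  have hgap := hF.gap_le hb (hx (k + 1)) hxs (by linarith) (hcen (k + 1))
  have hgap' : (b + s) * (b / (1 - b)) ≤ 2 * ν := by
    have h1 : b / (1 - b) ≤ 1 / 8 := by
      rw [div_le_iff₀ (by linarith)]; linarith
    have h2 : (b + s) * (b / (1 - b)) ≤ (b + s) * (1 / 8) := by gcongr
    nlinarith
  have htpos : 0 < t (k + 1) := pos_of_mul_pos_left (by linarith) hε.le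
  refine ⟨subset_closure (hx _), ?_⟩
  have h0 : c xstar ≤ c (x (k + 1)) := hmin (subset_closure (hx _))
  rw [abs_of_nonneg (sub_nonneg.2 h0)]
  exact le_of_mul_le_mul_left (by linarith) htpos

end IsSelfConcordantBarrier

/-! ### Invariance of the centering condition under both schemes -/

namespace IsSelfConcordant

variable {D : Set E} {F : E → ℝ} [FiniteDimensional ℝ E]

theorem pcStep_centered (hF : IsSelfConcordant 1 D F) (hb : Bornology.IsBounded D)
    {c : E →L[ℝ] ℝ} (hc : c ≠ 0) {p : ℝ × E} (hp : p.2 ∈ D)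
    (hcen : dualNorm F p.2 (grad F p.2 + p.1 • c) ≤ pcBeta) :
    (pcStep F c p).2 ∈ D ∧
      dualNorm F (pcStep F c p).2 (grad F (pcStep F c p).2 + (pcStep F c p).1 • c) ≤ pcBeta := by
  obtain ⟨t, x⟩ := p
  have hn := hF.dualNorm_pos hb hp hc
  simp only at hp hcen hn
  have hr : localNorm F x (-((pcGamma / dualNorm F x c) • hessInv F x c)) ≤ pcGamma := by
    rw [localNorm_neg, localNorm_smul _ _ _ (div_nonneg (by norm_num [pcGamma]) hn.le),
      hF.localNorm_hessInv hb hp, div_mul_cancel₀ _ hn.ne']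
  -- The predictor follows the linearized central path: the change of `∇F` predicted by the Hessian
  -- cancels the change of `t c`, so the predicted residual is the old one.
  have h1 := hF.dualNorm_grad_add_le hb hp hr (by norm_num [pcGamma])
    (t := t + pcGamma / dualNorm F x c) (c := c) (g := grad F x + t • c)
    (by rw [map_neg, map_smul, hF.hess_hessInv hb hp, add_smul]; abel) hcen
  rw [← sub_eq_add_neg] at h1
  -- The predictor leaves an error of at most `(0.06 + 0.254²/0.746)/0.746 < 0.1964`, and one Newton
  -- step returns it to `(0.1964/0.8036)² < 0.06`.
  have h2 := hF.newton_step hb h1.1 (l := 0.1964) (by norm_num)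
    (h1.2.trans (by norm_num [pcGamma, pcBeta]))
  exact ⟨h2.1, h2.2.trans (by norm_num [pcBeta])⟩

theorem classicalStep_centered (hF : IsSelfConcordant 1 D F) (hb : Bornology.IsBounded D)
    {c : E →L[ℝ] ℝ} (hc : c ≠ 0) {p : ℝ × E} (hp : p.2 ∈ D)
    (hcen : dualNorm F p.2 (grad F p.2 + p.1 • c) ≤ classicalBeta) :
    (classicalStep F c p).2 ∈ D ∧
      dualNorm F (classicalStep F c p).2
        (grad F (classicalStep F c p).2 + (classicalStep F c p).1 • c) ≤ classicalBeta := by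
  obtain ⟨t, x⟩ := p
  have hn := hF.dualNorm_pos hb hp hc
  simp only at hp hcen hn
  -- Increasing `t` raises the error from `1/9` to `1/9 + 5/36 = 1/4`; the Newton step brings it
  -- back to `((1/4)/(3/4))² = 1/9`.
  have h1 : dualNorm F x (grad F x + (t + classicalGamma / dualNorm F x c) • c) ≤ 1 / 4 := by
    refine hF.dualNorm_le hb hp (by norm_num) fun u => ?_
    have h3 := (le_abs_self _).trans (hF.abs_apply_le_dualNorm hb hp (grad F x + t • c) u)
    have h4 := (le_abs_self _).trans (hF.abs_apply_le_dualNorm hb hp c u)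
    have h5 := mul_le_mul_of_nonneg_right hcen (localNorm_nonneg F x u)
    have h6 : classicalGamma / dualNorm F x c * c u ≤ classicalGamma * localNorm F x u := by
      rw [div_mul_eq_mul_div, div_le_iff₀ hn]
      have : (0 : ℝ) ≤ classicalGamma := by norm_num [classicalGamma]
      nlinarith
    simp only [add_apply, smul_apply, smul_eq_mul, classicalBeta, classicalGamma] at *
    linarith
  have h2 := hF.newton_step hb hp (by norm_num) h1
  exact ⟨h2.1, h2.2.trans (by norm_num [classicalBeta])⟩

theorem pcIter_centered (hF : IsSelfConcordant 1 D F) (hb : Bornology.IsBounded D)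
    {c : E →L[ℝ] ℝ} (hc : c ≠ 0) {x₀ : E} (hx₀ : x₀ ∈ D)
    (hcen : dualNorm F x₀ (grad F x₀) ≤ pcBeta) (k : ℕ) :
    (pcIter F c x₀ k).2 ∈ D ∧ dualNorm F (pcIter F c x₀ k).2
      (grad F (pcIter F c x₀ k).2 + (pcIter F c x₀ k).1 • c) ≤ pcBeta := by
  induction k with
  | zero => exact ⟨hx₀, by simpa [pcIter] using hcen⟩
  | succ k ih => exact hF.pcStep_centered hb hc ih.1 ih.2

theorem classicalIter_centered (hF : IsSelfConcordant 1 D F) (hb : Bornology.IsBounded D)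
    {c : E →L[ℝ] ℝ} (hc : c ≠ 0) {x₀ : E} (hx₀ : x₀ ∈ D)
    (hcen : dualNorm F x₀ (grad F x₀) ≤ classicalBeta) (k : ℕ) :
    (classicalIter F c x₀ k).2 ∈ D ∧ dualNorm F (classicalIter F c x₀ k).2
      (grad F (classicalIter F c x₀ k).2 + (classicalIter F c x₀ k).1 • c) ≤ classicalBeta := by
  induction k with
  | zero => exact ⟨hx₀, by simpa [classicalIter] using hcen⟩
  | succ k ih => exact hF.classicalStep_centered hb hc ih.1 ih.2

end IsSelfConcordant

end PCPFS

theorem mainTheorem8 :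
    ∃ C : ℝ, 0 < C ∧
      ∀ (E : Type*) [NormedAddCommGroup E] [NormedSpace ℝ E] [FiniteDimensional ℝ E]
        (D : Set E) (F : E → ℝ) (ν : ℝ) (c : E →L[ℝ] ℝ) (xF xstar x₀ : E) (ε : ℝ),
        PCPFS.IsSelfConcordantBarrier ν D F →
        Bornology.IsBounded D →
        c ≠ 0 →
        PCPFS.IsAnalyticCenter D F xF →
        xstar ∈ closure D → IsMinOn c (closure D) xstar →
        x₀ ∈ D →
        0 < ε →
        (PCPFS.dualNorm F x₀ (PCPFS.grad F x₀) ≤ PCPFS.pcBeta →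
          (∀ N : ℕ,
            C * (√ν / PCPFS.pcGamma) * PCPFS.logFactor ν F c xF ε ≤ N →
              (PCPFS.pcIter F c x₀ N).2 ∈ closure D ∧
              |c (PCPFS.pcIter F c x₀ N).2 - c xstar| ≤ ε) ∧
          (∀ N : ℕ,
            3.94 * √ν * PCPFS.logFactor ν F c xF ε +
                C * (√ν + PCPFS.logFactor ν F c xF ε) ≤ N →
              (PCPFS.pcIter F c x₀ N).2 ∈ closure D ∧
              |c (PCPFS.pcIter F c x₀ N).2 - c xstar| ≤ ε)) ∧
        (PCPFS.dualNorm F x₀ (PCPFS.grad F x₀) ≤ PCPFS.classicalBeta →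
          ∀ N : ℕ,
            7.2 * √ν * PCPFS.logFactor ν F c xF ε +
                C * (√ν + PCPFS.logFactor ν F c xF ε) ≤ N →
              (PCPFS.classicalIter F c x₀ N).2 ∈ closure D ∧
              |c (PCPFS.classicalIter F c x₀ N).2 - c xstar| ≤ ε) := by
  -- From `L ≥ 1` and `√ν ≥ 1/6`, `300 (√ν + L) ≤ 2100 √ν L`, which the first claim absorbs into its
  -- product. The other two claims only need `C ≥ 300`, with `500/127 ≤ 3.94` and `36/5 = 7.2`.
  refine ⟨3000, by norm_num, ?_⟩
  intro E _ _ _ D F ν c xF xstar x₀ ε hF hb hc hxF hxs hmin hx₀ hε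
  have hsc := hF.selfConcordant
  have hL1 : 1 ≤ PCPFS.logFactor ν F c xF ε := le_max_left _ _
  have hs : 1 / 6 ≤ √ν := hF.one_div_six_le_sqrt_of_ne_zero hb hc hxF
  have hsL : √ν * 1 ≤ √ν * PCPFS.logFactor ν F c xF ε := by gcongr
  have hsL' : 1 / 6 * PCPFS.logFactor ν F c xF ε ≤ √ν * PCPFS.logFactor ν F c xF ε := by gcongr
  refine ⟨fun hcen => ?_, fun hcen N hN => ?_⟩
  · have key : ∀ N : ℕ, √ν / PCPFS.pcGamma * PCPFS.logFactor ν F c xF ε +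
        300 * (√ν + PCPFS.logFactor ν F c xF ε) ≤ N →
        (PCPFS.pcIter F c x₀ N).2 ∈ closure D ∧
          |c (PCPFS.pcIter F c x₀ N).2 - c xstar| ≤ ε := fun N hN =>
      hF.abs_sub_le_of_centered hb hc hxF hxs hmin hε (b := PCPFS.pcBeta) (γ := PCPFS.pcGamma)
        (by norm_num [PCPFS.pcBeta]) (by norm_num [PCPFS.pcBeta, PCPFS.pcGamma])
        (by norm_num [PCPFS.pcGamma]) (t := fun k => (PCPFS.pcIter F c x₀ k).1)
        (x := fun k => (PCPFS.pcIter F c x₀ k).2) rfl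
        (fun k => (hsc.pcIter_centered hb hc hx₀ hcen k).1)
        (fun k => (hsc.pcIter_centered hb hc hx₀ hcen k).2) (fun k => rfl) hN
    have e : √ν / PCPFS.pcGamma = 500 / 127 * √ν := by
      rw [PCPFS.pcGamma]; norm_num; ring
    rw [e] at key ⊢
    refine ⟨fun N hN => key N ?_, fun N hN => key N ?_⟩
    · linarith
    · norm_num at hN
      linarith
  · refine hF.abs_sub_le_of_centered hb hc hxF hxs hmin hε (b := PCPFS.classicalBeta)
      (γ := PCPFS.classicalGamma) (by norm_num [PCPFS.classicalBeta])
      (by norm_num [PCPFS.classicalBeta, PCPFS.classicalGamma])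
      (by norm_num [PCPFS.classicalGamma]) (t := fun k => (PCPFS.classicalIter F c x₀ k).1)
      (x := fun k => (PCPFS.classicalIter F c x₀ k).2) rfl
      (fun k => (hsc.classicalIter_centered hb hc hx₀ hcen k).1)
      (fun k => (hsc.classicalIter_centered hb hc hx₀ hcen k).2) (fun k => rfl) ?_
    have e : √ν / PCPFS.classicalGamma = 36 / 5 * √ν := by
      rw [PCPFS.classicalGamma]; ring
    rw [e]
    norm_num at hN
    linarith
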